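/- Let $1<p<\infty$ and $p^*=p/(p-1)$. For $d\ge 1$ and a bounded open set $\Omega\subset\mathbb{R}^d$ (in particular, a bounded Lipschitz domain), let $V=W_0^{1,p}(\Omega)$ be the closure of $C_0^\infty(\Omega)$ in $W^{1,p}(\Omega)$, normed by $\|v\|_V=\big(\int_\Omega|\nabla v|^p\big)^{1/p}$, let $V^*$ be its dual with the dual norm, and let $A:V\to V^*$ be the $p$-Laplacian, $$\langle A(u),v\rangle=\int_\Omega|\nabla u|^{p-2}\,\nabla u\cdot\nabla v\,dx .$$ Consider positive constants $C_L,C_M$ (when $p\ge2$), respectively $c_L,c_M$ (when $1<p<2$), such that for all $u,w\in V$ $$\|A(u)-A(w)\|_{V^*}\le\begin{cases}C_L(\|u\|_V+\|w\|_V)^{p-2}\|u-w\|_V & p\ge2,\\ c_L\|u-w\|_V^{p-1} & 1<p<2,\end{cases}$$ $$\langle A(u)-A(w),u-w\rangle\ge\begin{cases}C_M\|u-w\|_V^{p} & p\ge2,\\ c_M(\|u\|_V+\|w\|_V)^{p-2}\|u-w\|_V^{2} & 1<p<2\end{cases}$$ (in the last line the right-hand side is read as $0$ if $u=w=0$). Such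 constants exist and can be chosen depending only on $p$. For any such constants the following holds. Let $F\in V^*$ and let $u\in V$ satisfy $A(u)=F$. Let $U_h\subset V$ be a finite-dimensional subspace and let $u_h\in U_h$ be a solution of the residual minimization problem, that is, a minimizer of $w_h\mapsto\frac1{p^*}\|F-A(w_h)\|_{V^*}^{p^*}$ over $U_h$. Let $r\in V$ be the residual representative, $J_{p,V}(r)=F-A(u_h)$, where $J_{p,V}:V\to V^*$ is the duality map, characterized by $\langle J_{p,V}(x),x\rangle=\|J_{p,V}(x)\|_{V^*}\|x\|_V$ and $\|J_{p,V}(x)\|_{V^*}=\|x\|_V^{p-1}$. Let $C_{BM}(V)$ be the Banach--Mazur constant of $V$: the supremum, over all two-dimensional subspaces $W\subset V$, of $d(W)^2$, where $d(W)=\inf_T\|T\|\,\|T^{-1}\|$ over all linear isomorphisms $T$ from $W$ to the Euclidean plane (and $C_{BM}(V)=1$ if $\dim V\le1$). Then $$\begin{cases}C_1\|r\|_V^{p-1}\le\|u-u_h\|_V\le C_2\|r\|_V & \text{if }p\ge2,\\ c_1\|r\|_V\le\|u-u_h\|_V\le c_2\|r\|_V^{p-1} & \text{if }1<p<2,\end{cases}$$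 where $$C_1=C_L^{-1}(1+C_{BM}(V))^{2-p}\|F\|_{V^*}^{-\frac{p-2}{p-1}},\qquad C_2=C_M^{-\frac1{p-1}},$$ $$c_1=c_L^{-\frac1{p-1}},\qquad c_2=c_M^{-1}\big(1+2^{\frac1{p-1}}\big)^{2-p}\|F\|_{V^*}^{\frac{2-p}{p-1}} .$$ (If $F=0$, then $u=u_h=r=0$, and the lower bound for $p>2$ is read as $0\le0$.) -/

import Mathlib

open MeasureTheory Set
open scoped ContDiff ENNReal

noncomputable section

namespace PLaplaceMinRes

/-! ### Duality map, residual minimization and Banach–Mazur constant of a normed space -/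

section Abstract

/-- `J` is a duality map of weight `t ↦ t ^ (p - 1)` on `X`. -/
def IsDualityMap (p : ℝ) {X : Type*} [NormedAddCommGroup X] [NormedSpace ℝ X]
    (J : X → StrongDual ℝ X) : Prop :=
  ∀ x, J x x = ‖J x‖ * ‖x‖ ∧ ‖J x‖ = ‖x‖ ^ (p - 1)

theorem exists_isDualityMap (p : ℝ) [hp : Fact (1 < p)] (X : Type*) [NormedAddCommGroup X]
    [NormedSpace ℝ X] : ∃ J : X → StrongDual ℝ X, IsDualityMap p J := by
  have hp1 : p - 1 ≠ 0 := by have := hp.out; linarith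
  have key : ∀ x : X, ∃ φ : StrongDual ℝ X, φ x = ‖φ‖ * ‖x‖ ∧ ‖φ‖ = ‖x‖ ^ (p - 1) := by
    intro x
    by_cases hx : ‖x‖ = 0
    · exact ⟨0, by simp, by simp [hx, Real.zero_rpow hp1]⟩
    · obtain ⟨g, hg1, hgx⟩ := exists_dual_vector ℝ x hx
      have hn : ‖‖x‖ ^ (p - 1) • g‖ = ‖x‖ ^ (p - 1) := by
        rw [norm_smul, hg1, mul_one, Real.norm_eq_abs, abs_of_nonneg (by positivity)]
      refine ⟨‖x‖ ^ (p - 1) • g, ?_, hn⟩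
      rw [hn]
      simp [hgx]
  choose J hJ using key
  exact ⟨J, hJ⟩

/-- The duality map `J_{p,X}` of a normed space `X` (it exists by the Hahn–Banach theorem, and it
is the only map with the two defining properties when the dual of `X` is strictly convex). -/
def dualityMap (p : ℝ) [Fact (1 < p)] (X : Type*) [NormedAddCommGroup X] [NormedSpace ℝ X] :
    X → StrongDual ℝ X :=
  Classical.choose (exists_isDualityMap p X)

theorem dualityMap_spec (p : ℝ) [Fact (1 < p)] (X : Type*) [NormedAddCommGroup X]
    [NormedSpace ℝ X] : IsDualityMap p (dualityMap p X) :=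
  Classical.choose_spec (exists_isDualityMap p X)

/-- `uh` minimizes `w ↦ (1 / p*) ‖F - A w‖ ^ p*` over the subspace `Uh`, where `p* = p / (p - 1)`
and the norm is the dual norm. -/
def IsMinResSolution (p : ℝ) {U V : Type*} [AddCommGroup U] [Module ℝ U]
    [NormedAddCommGroup V] [NormedSpace ℝ V] (A : U → StrongDual ℝ V) (F : StrongDual ℝ V)
    (Uh : Submodule ℝ U) (uh : U) : Prop :=
  uh ∈ Uh ∧
    IsMinOn (fun w => 1 / (p / (p - 1)) * ‖F - A w‖ ^ (p / (p - 1))) (Uh : Set U) uh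

/-- The (multiplicative) Banach–Mazur distance of a normed space `W` to the Euclidean plane. -/
def distToEuclideanPlane (W : Type*) [NormedAddCommGroup W] [NormedSpace ℝ W] : ℝ :=
  ⨅ T : W ≃L[ℝ] EuclideanSpace ℝ (Fin 2),
    ‖(T : W →L[ℝ] EuclideanSpace ℝ (Fin 2))‖ * ‖(T.symm : EuclideanSpace ℝ (Fin 2) →L[ℝ] W)‖

/-- The Banach–Mazur constant of `X`: the supremum, over all two-dimensional subspaces `W` of `X`,
of the square of the Banach–Mazur distance of `W` to the Euclidean plane. The value `1`, a lower
bound of all these squares, is inserted so that the constant is `1` when `dim X ≤ 1`. -/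
def banachMazurConst (X : Type*) [NormedAddCommGroup X] [NormedSpace ℝ X] : ℝ :=
  sSup (insert 1
    {c | ∃ W : Submodule ℝ X, Module.finrank ℝ W = 2 ∧ c = distToEuclideanPlane W ^ 2})

end Abstract

/-! ### The Sobolev spaces -/

/-- A bounded open subset of `ℝ^d`. -/
structure BoundedOpen (d : ℕ) where
  carrier : Set (EuclideanSpace ℝ (Fin d))
  isOpen : IsOpen carrier
  isBounded : Bornology.IsBounded carrier

section Sobolev

variable {d : ℕ}

instance fact_one_le_ofReal (p : ℝ) [hp : Fact (1 < p)] : Fact (1 ≤ ENNReal.ofReal p) :=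
  ⟨by simpa using hp.out.le⟩

/-- Lebesgue measure on `Ω`. -/
abbrev BoundedOpen.measure (Ω : BoundedOpen d) : Measure (EuclideanSpace ℝ (Fin d)) :=
  volume.restrict Ω.carrier

instance (Ω : BoundedOpen d) : IsFiniteMeasure Ω.measure :=
  ⟨by simpa using Ω.isBounded.measure_lt_top⟩

/-- `L^p(Ω)`. -/
abbrev LebesgueFun (Ω : BoundedOpen d) (p : ℝ) : Type :=
  Lp ℝ (ENNReal.ofReal p) Ω.measure

/-- `L^p(Ω; ℝ^d)`, with the Euclidean norm on `ℝ^d`. -/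
abbrev LebesgueVec (Ω : BoundedOpen d) (p : ℝ) : Type :=
  Lp (EuclideanSpace ℝ (Fin d)) (ENNReal.ofReal p) Ω.measure

theorem LebesgueVec.norm_eq {Ω : BoundedOpen d} {p : ℝ} [hp : Fact (1 < p)]
    (f : LebesgueVec Ω p) : ‖f‖ = (∫ x in Ω.carrier, ‖f x‖ ^ p) ^ (1 / p) := by
  have hp0 : 0 < p := by linarith [hp.out]
  rw [Lp.norm_def, (Lp.memLp f).eLpNorm_eq_integral_rpow_norm (by simpa using hp0)
    ENNReal.ofReal_ne_top, ENNReal.toReal_ofReal hp0.le, ENNReal.toReal_ofReal (by positivity),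
    one_div]

/-- Smooth functions with compact support in `Ω`. -/
structure IsTestFun (Ω : BoundedOpen d) (φ : EuclideanSpace ℝ (Fin d) → ℝ) : Prop where
  smooth : ContDiff ℝ ∞ φ
  compact : HasCompactSupport φ
  support : tsupport φ ⊆ Ω.carrier

/-- `g` is the weak gradient of `v` on `Ω`. -/
def IsWeakGradient {Ω : BoundedOpen d} {p : ℝ} (v : LebesgueFun Ω p) (g : LebesgueVec Ω p) :
    Prop :=
  ∀ φ, IsTestFun Ω φ → ∀ i : Fin d,
    ∫ x in Ω.carrier, v x * gradient φ x i = -∫ x in Ω.carrier, g x i * φ x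

theorem IsTestFun.zero (Ω : BoundedOpen d) : IsTestFun Ω (0 : EuclideanSpace ℝ (Fin d) → ℝ) where
  smooth := contDiff_const
  compact := HasCompactSupport.zero
  support := by simp [tsupport]

theorem IsTestFun.add {Ω : BoundedOpen d} {φ ψ : EuclideanSpace ℝ (Fin d) → ℝ}
    (hφ : IsTestFun Ω φ) (hψ : IsTestFun Ω ψ) : IsTestFun Ω (φ + ψ) where
  smooth := hφ.smooth.add hψ.smooth
  compact := hφ.compact.add hψ.compact
  support := (tsupport_add φ ψ).trans (union_subset hφ.support hψ.support)

theorem IsTestFun.smul {Ω : BoundedOpen d} {φ : EuclideanSpace ℝ (Fin d) → ℝ}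
    (hφ : IsTestFun Ω φ) (c : ℝ) : IsTestFun Ω (c • φ) where
  smooth := contDiff_const.smul hφ.smooth
  compact := hφ.compact.smul_left (f := fun _ => c)
  support := (closure_mono (Function.support_const_smul_subset c φ)).trans hφ.support

theorem IsTestFun.differentiableAt {Ω : BoundedOpen d} {φ : EuclideanSpace ℝ (Fin d) → ℝ}
    (hφ : IsTestFun Ω φ) (x : EuclideanSpace ℝ (Fin d)) : DifferentiableAt ℝ φ x :=
  (hφ.smooth.differentiable (by simp)).differentiableAt

theorem IsTestFun.continuous_gradient {Ω : BoundedOpen d} {φ : EuclideanSpace ℝ (Fin d) → ℝ}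
    (hφ : IsTestFun Ω φ) : Continuous (gradient φ) :=
  (LinearIsometryEquiv.continuous _).comp (hφ.smooth.continuous_fderiv (by simp))

theorem IsTestFun.compact_gradient {Ω : BoundedOpen d} {φ : EuclideanSpace ℝ (Fin d) → ℝ}
    (hφ : IsTestFun Ω φ) : HasCompactSupport (gradient φ) :=
  (hφ.compact.fderiv (𝕜 := ℝ)).comp_left (map_zero _)

theorem integrable_fun {Ω : BoundedOpen d} {p : ℝ} [Fact (1 < p)] (v : LebesgueFun Ω p) :
    Integrable v Ω.measure :=
  (Lp.memLp v).integrable Fact.out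

theorem integrable_coord {Ω : BoundedOpen d} {p : ℝ} [Fact (1 < p)] (g : LebesgueVec Ω p)
    (i : Fin d) : Integrable (fun x => g x i) Ω.measure :=
  (EuclideanSpace.proj (𝕜 := ℝ) i).integrable_comp ((Lp.memLp g).integrable Fact.out)

theorem integrable_mul_gradient {Ω : BoundedOpen d} {p : ℝ} [Fact (1 < p)]
    (v : LebesgueFun Ω p) {φ : EuclideanSpace ℝ (Fin d) → ℝ} (hφ : IsTestFun Ω φ) (i : Fin d) :
    Integrable (fun x => v x * gradient φ x i) Ω.measure := by
  obtain ⟨C, hC⟩ := hφ.compact_gradient.exists_bound_of_continuous hφ.continuous_gradient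
  refine (integrable_fun v).mul_bdd (c := C) ?_ (Filter.Eventually.of_forall fun x => ?_)
  · exact ((EuclideanSpace.proj (𝕜 := ℝ) i).continuous.comp
      hφ.continuous_gradient).aestronglyMeasurable
  · exact (PiLp.norm_apply_le _ i).trans (hC x)

theorem integrable_coord_mul {Ω : BoundedOpen d} {p : ℝ} [Fact (1 < p)]
    (g : LebesgueVec Ω p) {φ : EuclideanSpace ℝ (Fin d) → ℝ} (hφ : IsTestFun Ω φ) (i : Fin d) :
    Integrable (fun x => g x i * φ x) Ω.measure := by
  obtain ⟨C, hC⟩ := hφ.compact.exists_bound_of_continuous hφ.smooth.continuous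
  exact (integrable_coord g i).mul_bdd (c := C) hφ.smooth.continuous.aestronglyMeasurable
    (Filter.Eventually.of_forall hC)

/-- `W^{1,p}(Ω)`, as the space of pairs `(v, ∇v)` with `v ∈ L^p(Ω)` whose weak gradient `∇v` is in
`L^p`. Its topology is that of `L^p`-convergence of the function and of its gradient, that is, the
topology of the `W^{1,p}`-norm. -/
def sobolevSpace (Ω : BoundedOpen d) (p : ℝ) [Fact (1 < p)] :
    Submodule ℝ (LebesgueFun Ω p × LebesgueVec Ω p) where
  carrier := {x | IsWeakGradient x.1 x.2}
  zero_mem' := by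
    intro φ _ i
    have h1 : ∫ x in Ω.carrier, (0 : LebesgueFun Ω p) x * gradient φ x i = 0 := by
      rw [← integral_zero (EuclideanSpace ℝ (Fin d)) ℝ (μ := Ω.measure)]
      refine integral_congr_ae ?_
      filter_upwards [Lp.coeFn_zero ℝ (ENNReal.ofReal p) Ω.measure] with x hx
      simp only [hx, Pi.zero_apply, zero_mul]
    have h2 : ∫ x in Ω.carrier, (0 : LebesgueVec Ω p) x i * φ x = 0 := by
      rw [← integral_zero (EuclideanSpace ℝ (Fin d)) ℝ (μ := Ω.measure)]
      refine integral_congr_ae ?_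
      filter_upwards [Lp.coeFn_zero (EuclideanSpace ℝ (Fin d)) (ENNReal.ofReal p) Ω.measure]
        with x hx
      simp only [hx, Pi.zero_apply, PiLp.zero_apply, zero_mul]
    change ∫ x in Ω.carrier, (0 : LebesgueFun Ω p) x * gradient φ x i
      = -∫ x in Ω.carrier, (0 : LebesgueVec Ω p) x i * φ x
    rw [h1, h2, neg_zero]
  add_mem' := by
    rintro ⟨v, g⟩ ⟨w, k⟩ hv hw φ hφ i
    have h1 : ∫ x in Ω.carrier, (v + w : LebesgueFun Ω p) x * gradient φ x i
        = ∫ x in Ω.carrier, v x * gradient φ x i + w x * gradient φ x i := by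
      refine integral_congr_ae ?_
      filter_upwards [Lp.coeFn_add v w] with x hx
      simp only [hx, Pi.add_apply, add_mul]
    have h2 : ∫ x in Ω.carrier, (g + k : LebesgueVec Ω p) x i * φ x
        = ∫ x in Ω.carrier, g x i * φ x + k x i * φ x := by
      refine integral_congr_ae ?_
      filter_upwards [Lp.coeFn_add g k] with x hx
      simp only [hx, Pi.add_apply, PiLp.add_apply, add_mul]
    change ∫ x in Ω.carrier, (v + w : LebesgueFun Ω p) x * gradient φ x i
      = -∫ x in Ω.carrier, (g + k : LebesgueVec Ω p) x i * φ x
    rw [h1, h2, integral_add (integrable_mul_gradient v hφ i) (integrable_mul_gradient w hφ i),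
      integral_add (integrable_coord_mul g hφ i) (integrable_coord_mul k hφ i), neg_add]
    exact congrArg₂ (· + ·) (hv φ hφ i) (hw φ hφ i)
  smul_mem' := by
    rintro c ⟨v, g⟩ hv φ hφ i
    have h1 : ∫ x in Ω.carrier, (c • v : LebesgueFun Ω p) x * gradient φ x i
        = c * ∫ x in Ω.carrier, v x * gradient φ x i := by
      rw [← integral_const_mul]
      refine integral_congr_ae ?_
      filter_upwards [Lp.coeFn_smul c v] with x hx
      simp [hx, mul_assoc]
    have h2 : ∫ x in Ω.carrier, (c • g : LebesgueVec Ω p) x i * φ x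
        = c * ∫ x in Ω.carrier, g x i * φ x := by
      rw [← integral_const_mul]
      refine integral_congr_ae ?_
      filter_upwards [Lp.coeFn_smul c g] with x hx
      simp [hx, mul_assoc]
    change ∫ x in Ω.carrier, (c • v : LebesgueFun Ω p) x * gradient φ x i
      = -∫ x in Ω.carrier, (c • g : LebesgueVec Ω p) x i * φ x
    rw [h1, h2, ← mul_neg]
    exact congrArg (c * ·) (hv φ hφ i)

/-- `C_0^∞(Ω)` as a subspace of `W^{1,p}(Ω)`. -/
def testSubspace (Ω : BoundedOpen d) (p : ℝ) [Fact (1 < p)] : Submodule ℝ (sobolevSpace Ω p) where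
  carrier := {x | ∃ φ, IsTestFun Ω φ ∧ x.1.1 =ᵐ[Ω.measure] φ ∧ x.1.2 =ᵐ[Ω.measure] gradient φ}
  zero_mem' := by
    refine ⟨0, IsTestFun.zero Ω, Lp.coeFn_zero _ _ _, ?_⟩
    have h0 : gradient (0 : EuclideanSpace ℝ (Fin d) → ℝ) = 0 := by
      ext1 x
      simp [gradient]
    rw [h0]
    exact Lp.coeFn_zero _ _ _
  add_mem' := by
    rintro x y ⟨φ, hφ, hx1, hx2⟩ ⟨ψ, hψ, hy1, hy2⟩
    refine ⟨φ + ψ, hφ.add hψ, (Lp.coeFn_add x.1.1 y.1.1).trans (hx1.add hy1), ?_⟩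
    have h0 : gradient (φ + ψ) = gradient φ + gradient ψ := by
      ext1 z
      simp [gradient, fderiv_add (hφ.differentiableAt z) (hψ.differentiableAt z)]
    rw [h0]
    exact (Lp.coeFn_add x.1.2 y.1.2).trans (hx2.add hy2)
  smul_mem' := by
    rintro c x ⟨φ, hφ, hx1, hx2⟩
    refine ⟨c • φ, hφ.smul c, (Lp.coeFn_smul c x.1.1).trans (hx1.const_smul c), ?_⟩
    have h0 : gradient (c • φ) = c • gradient φ := by
      ext1 z
      simp [gradient, fderiv_const_smul (hφ.differentiableAt z)]
    rw [h0]
    exact (Lp.coeFn_smul c x.1.2).trans (hx2.const_smul c)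

/-- `W_0^{1,p}(Ω)`, the closure of `C_0^∞(Ω)` in `W^{1,p}(Ω)`, as a vector space; the norm
`(∫ |∇v|^p)^{1/p}` is put on it below. -/
def SobolevZero (Ω : BoundedOpen d) (p : ℝ) [Fact (1 < p)] : Type :=
  (testSubspace Ω p).topologicalClosure

instance (Ω : BoundedOpen d) (p : ℝ) [Fact (1 < p)] : AddCommGroup (SobolevZero Ω p) :=
  inferInstanceAs (AddCommGroup (testSubspace Ω p).topologicalClosure)

instance (Ω : BoundedOpen d) (p : ℝ) [Fact (1 < p)] : Module ℝ (SobolevZero Ω p) :=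
  inferInstanceAs (Module ℝ (testSubspace Ω p).topologicalClosure)

/-- The element of `L^p(Ω)` underlying an element of `W_0^{1,p}(Ω)`. -/
def SobolevZero.toFun (Ω : BoundedOpen d) (p : ℝ) [Fact (1 < p)] :
    SobolevZero Ω p →ₗ[ℝ] LebesgueFun Ω p :=
  LinearMap.fst ℝ _ _ ∘ₗ (sobolevSpace Ω p).subtype ∘ₗ (testSubspace Ω p).topologicalClosure.subtype

/-- The weak gradient of an element of `W_0^{1,p}(Ω)`. -/
def SobolevZero.grad (Ω : BoundedOpen d) (p : ℝ) [Fact (1 < p)] :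
    SobolevZero Ω p →ₗ[ℝ] LebesgueVec Ω p :=
  LinearMap.snd ℝ _ _ ∘ₗ (sobolevSpace Ω p).subtype ∘ₗ (testSubspace Ω p).topologicalClosure.subtype

/-- A test function is controlled by its gradient along a segment that leaves `Ω`. -/
theorem IsTestFun.enorm_le_lintegral {Ω : BoundedOpen d} {φ : EuclideanSpace ℝ (Fin d) → ℝ}
    (hφ : IsTestFun Ω φ) {e : EuclideanSpace ℝ (Fin d)} (he : ‖e‖ = 1) {L : ℝ} (hL : 0 ≤ L)
    {x : EuclideanSpace ℝ (Fin d)} (hx : x + L • e ∉ Ω.carrier) :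
    ‖φ x‖ₑ ≤ ∫⁻ t in Ioc 0 L, ‖gradient φ (x + t • e)‖ₑ := by
  have hder : ∀ t : ℝ, HasDerivAt (fun t : ℝ => φ (x + t • e))
      (inner ℝ (gradient φ (x + t • e)) e) t := by
    intro t
    have h1 : HasDerivAt (fun t : ℝ => x + t • e) e t := by
      simpa using ((hasDerivAt_id t).smul_const e).const_add x
    have h2 := (hφ.differentiableAt (x + t • e)).hasFDerivAt.comp_hasDerivAt t h1
    have h3 : inner ℝ (gradient φ (x + t • e)) e = fderiv ℝ φ (x + t • e) e := by
      rw [gradient, InnerProductSpace.toDual_symm_apply]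
    rw [h3]
    exact h2
  have hcont : Continuous fun t : ℝ => (inner ℝ (gradient φ (x + t • e)) e : ℝ) :=
    (hφ.continuous_gradient.comp (by fun_prop)).inner continuous_const
  have hFTC := intervalIntegral.integral_eq_sub_of_hasDerivAt (a := 0) (b := L)
    (fun t _ => hder t) (hcont.intervalIntegrable 0 L)
  have hend : φ (x + L • e) = 0 := image_eq_zero_of_notMem_tsupport fun h => hx (hφ.support h)
  rw [hend, zero_smul, add_zero, zero_sub, intervalIntegral.integral_of_le hL] at hFTC
  calc ‖φ x‖ₑ = ‖∫ t in Ioc 0 L, (inner ℝ (gradient φ (x + t • e)) e : ℝ)‖ₑ := by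
        rw [hFTC, enorm_neg]
    _ ≤ ∫⁻ t in Ioc 0 L, ‖(inner ℝ (gradient φ (x + t • e)) e : ℝ)‖ₑ :=
        enorm_integral_le_lintegral_enorm _
    _ ≤ ∫⁻ t in Ioc 0 L, ‖gradient φ (x + t • e)‖ₑ := by
        refine lintegral_mono fun t => ?_
        rw [enorm_le_iff_norm_le]
        simpa [he] using norm_inner_le_norm (𝕜 := ℝ) (gradient φ (x + t • e)) e

/-- Poincaré's inequality for test functions. -/
theorem poincare_test [NeZero d] (Ω : BoundedOpen d) (p : ℝ) [hp : Fact (1 < p)] :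
    ∃ C : ℝ, ∀ φ, IsTestFun Ω φ →
      eLpNorm φ (ENNReal.ofReal p) Ω.measure
        ≤ ENNReal.ofReal C * eLpNorm (gradient φ) (ENNReal.ofReal p) Ω.measure := by
  have hp1 := hp.out
  have hp0 : 0 < p := by linarith
  have hpe0 : ENNReal.ofReal p ≠ 0 := by simpa using hp0
  obtain ⟨R, hR⟩ := Ω.isBounded.subset_closedBall 0
  let L : ℝ := 2 * |R| + 1
  have hL : 0 < L := by positivity
  let e : EuclideanSpace ℝ (Fin d) := EuclideanSpace.single 0 1
  have he : ‖e‖ = 1 := by simp [e]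
  refine ⟨L, fun φ hφ => ?_⟩
  have hout : ∀ x ∈ Ω.carrier, x + L • e ∉ Ω.carrier := by
    intro x hx hx'
    have h1 : ‖x‖ ≤ R := by simpa using hR hx
    have h2 : ‖x + L • e‖ ≤ R := by simpa using hR hx'
    have h3 : ‖L • e‖ = L := by rw [norm_smul, he, mul_one, Real.norm_of_nonneg hL.le]
    have h4 : ‖L • e‖ ≤ ‖x + L • e‖ + ‖x‖ := by
      simpa using norm_sub_le (x + L • e) x
    have := le_abs_self R
    simp only [h3, L] at h4
    linarith
  have hmeas : Measurable fun y => ‖gradient φ y‖ₑ ^ p :=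
    hφ.continuous_gradient.measurable.enorm.pow_const p
  -- pointwise bound
  have hpt : ∀ x ∈ Ω.carrier, ‖φ x‖ₑ ^ p ≤
      ENNReal.ofReal L ^ (p - 1) * ∫⁻ t in Ioc 0 L, ‖gradient φ (x + t • e)‖ₑ ^ p := by
    intro x hx
    have h1 := hφ.enorm_le_lintegral he hL.le (hout x hx)
    have hc : Continuous fun t : ℝ => gradient φ (x + t • e) :=
      hφ.continuous_gradient.comp (by fun_prop)
    have h2 := eLpNorm_le_eLpNorm_mul_rpow_measure_univ (μ := volume.restrict (Ioc 0 L))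
      (p := 1) (q := ENNReal.ofReal p) Fact.out
      (f := fun t : ℝ => gradient φ (x + t • e)) hc.aestronglyMeasurable
    rw [eLpNorm_one_eq_lintegral_enorm,
      eLpNorm_eq_lintegral_rpow_enorm_toReal hpe0 ENNReal.ofReal_ne_top,
      ENNReal.toReal_ofReal hp0.le, Measure.restrict_apply_univ, Real.volume_Ioc, sub_zero,
      ENNReal.toReal_one] at h2
    calc ‖φ x‖ₑ ^ p ≤ ((∫⁻ t in Ioc 0 L, ‖gradient φ (x + t • e)‖ₑ ^ p) ^ (1 / p)
            * ENNReal.ofReal L ^ (1 / 1 - 1 / p)) ^ p :=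
          ENNReal.rpow_le_rpow (h1.trans h2) hp0.le
      _ = _ := by
          rw [ENNReal.mul_rpow_of_nonneg _ _ hp0.le, ← ENNReal.rpow_mul, ← ENNReal.rpow_mul,
            one_div_mul_cancel hp0.ne', ENNReal.rpow_one, mul_comm]
          congr 2
          field_simp
  have hsupp : ∫⁻ y, ‖gradient φ y‖ₑ ^ p = ∫⁻ y in Ω.carrier, ‖gradient φ y‖ₑ ^ p := by
    rw [← lintegral_indicator Ω.isOpen.measurableSet]
    refine lintegral_congr fun y => ?_
    by_cases hy : y ∈ Ω.carrier
    · rw [indicator_of_mem hy]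
    · rw [indicator_of_notMem hy]
      have h0 : fderiv ℝ φ y = 0 :=
        image_eq_zero_of_notMem_tsupport fun h =>
          hy (hφ.support (tsupport_fderiv_subset ℝ h))
      simp [gradient, h0, hp0]
  have hint : ∫⁻ x in Ω.carrier, ‖φ x‖ₑ ^ p ≤
      ENNReal.ofReal L ^ p * ∫⁻ y in Ω.carrier, ‖gradient φ y‖ₑ ^ p := by
    calc ∫⁻ x in Ω.carrier, ‖φ x‖ₑ ^ p
        ≤ ∫⁻ x in Ω.carrier, ENNReal.ofReal L ^ (p - 1) *
            ∫⁻ t in Ioc 0 L, ‖gradient φ (x + t • e)‖ₑ ^ p :=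
          setLIntegral_mono' Ω.isOpen.measurableSet hpt
      _ ≤ ∫⁻ x, ENNReal.ofReal L ^ (p - 1) *
            ∫⁻ t in Ioc 0 L, ‖gradient φ (x + t • e)‖ₑ ^ p := setLIntegral_le_lintegral _ _
      _ = ENNReal.ofReal L ^ (p - 1) *
            ∫⁻ x, ∫⁻ t in Ioc 0 L, ‖gradient φ (x + t • e)‖ₑ ^ p := by
          refine lintegral_const_mul' _ _ ?_
          exact ENNReal.rpow_ne_top_of_nonneg (by linarith) ENNReal.ofReal_ne_top
      _ = ENNReal.ofReal L ^ (p - 1) *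
            ∫⁻ t in Ioc 0 L, ∫⁻ x, ‖gradient φ (x + t • e)‖ₑ ^ p := by
          rw [lintegral_lintegral_swap]
          have hm : Measurable fun z : EuclideanSpace ℝ (Fin d) × ℝ => z.1 + z.2 • e := by
            fun_prop
          exact (hmeas.comp hm).aemeasurable
      _ = ENNReal.ofReal L ^ (p - 1) *
            ∫⁻ _ in Ioc 0 L, ∫⁻ y, ‖gradient φ y‖ₑ ^ p := by
          congr 1
          refine lintegral_congr fun t => ?_
          exact lintegral_add_right_eq_self (fun y => ‖gradient φ y‖ₑ ^ p) (t • e)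
      _ = ENNReal.ofReal L ^ p * ∫⁻ y in Ω.carrier, ‖gradient φ y‖ₑ ^ p := by
          rw [setLIntegral_const, Real.volume_Ioc, sub_zero, hsupp, mul_comm (∫⁻ _ in _, _),
            ← mul_assoc]
          congr 1
          have hL0 : ENNReal.ofReal L ≠ 0 := by simpa using hL
          conv_lhs => rw [← ENNReal.rpow_one (ENNReal.ofReal L), ← ENNReal.rpow_mul, one_mul]
          rw [← ENNReal.rpow_add _ _ hL0 ENNReal.ofReal_ne_top, sub_add_cancel]
  rw [eLpNorm_eq_lintegral_rpow_enorm_toReal hpe0 ENNReal.ofReal_ne_top,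
    eLpNorm_eq_lintegral_rpow_enorm_toReal hpe0 ENNReal.ofReal_ne_top,
    ENNReal.toReal_ofReal hp0.le]
  refine (ENNReal.rpow_le_rpow hint (by positivity)).trans_eq ?_
  rw [ENNReal.mul_rpow_of_nonneg _ _ (by positivity), ← ENNReal.rpow_mul,
    mul_one_div_cancel hp0.ne', ENNReal.rpow_one]

/-- Poincaré's inequality in `W_0^{1,p}(Ω)`. -/
theorem poincare [NeZero d] (Ω : BoundedOpen d) (p : ℝ) [Fact (1 < p)] :
    ∃ C : ℝ, 0 ≤ C ∧ ∀ v : SobolevZero Ω p,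
      ‖SobolevZero.toFun Ω p v‖ ≤ C * ‖SobolevZero.grad Ω p v‖ := by
  obtain ⟨C, hC⟩ := poincare_test Ω p
  refine ⟨max C 0, le_max_right _ _, fun v => ?_⟩
  have hcl : IsClosed {x : sobolevSpace Ω p | ‖x.1.1‖ ≤ max C 0 * ‖x.1.2‖} :=
    isClosed_le (by fun_prop) (by fun_prop)
  have hsub : ((testSubspace Ω p : Submodule ℝ (sobolevSpace Ω p)) : Set (sobolevSpace Ω p))
      ⊆ {x : sobolevSpace Ω p | ‖x.1.1‖ ≤ max C 0 * ‖x.1.2‖} := by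
    rintro x ⟨φ, hφ, h1, h2⟩
    have h := hC φ hφ
    rw [← eLpNorm_congr_ae h1, ← eLpNorm_congr_ae h2] at h
    have h' := ENNReal.toReal_mono
      (ENNReal.mul_ne_top ENNReal.ofReal_ne_top (Lp.eLpNorm_ne_top x.1.2)) h
    rw [ENNReal.toReal_mul, ENNReal.toReal_ofReal'] at h'
    simpa only [mem_ofPred_eq, Lp.norm_def] using h'
  exact closure_minimal hsub hcl v.2

theorem SobolevZero.grad_injective [NeZero d] (Ω : BoundedOpen d) (p : ℝ) [Fact (1 < p)] :
    Function.Injective (SobolevZero.grad Ω p) := by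
  rw [injective_iff_map_eq_zero]
  intro v hv
  obtain ⟨C, _, hC⟩ := poincare Ω p
  have h1 : SobolevZero.toFun Ω p v = 0 := by
    have := hC v
    rw [hv, norm_zero, mul_zero] at this
    exact norm_le_zero_iff.mp this
  exact Subtype.ext (Subtype.ext (Prod.ext h1 hv))

/-- `W_0^{1,p}(Ω)` is normed by `‖v‖ = ‖∇v‖_{L^p} = (∫ |∇v|^p)^{1/p}`. -/
instance [NeZero d] (Ω : BoundedOpen d) (p : ℝ) [Fact (1 < p)] :
    NormedAddCommGroup (SobolevZero Ω p) :=
  NormedAddCommGroup.induced _ _ (SobolevZero.grad Ω p) (SobolevZero.grad_injective Ω p)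

instance [NeZero d] (Ω : BoundedOpen d) (p : ℝ) [Fact (1 < p)] : NormedSpace ℝ (SobolevZero Ω p) :=
  NormedSpace.induced ℝ _ _ (SobolevZero.grad Ω p)

theorem SobolevZero.norm_eq [NeZero d] {Ω : BoundedOpen d} {p : ℝ} [hp : Fact (1 < p)]
    (v : SobolevZero Ω p) :
    ‖v‖ = (∫ x in Ω.carrier, ‖SobolevZero.grad Ω p v x‖ ^ p) ^ (1 / p) :=
  LebesgueVec.norm_eq (SobolevZero.grad Ω p v)

end Sobolev

/-! ### The `p`-Laplacian -/

section Operator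

variable {d : ℕ}

theorem memLp_norm_rpow_sub_one {Ω : BoundedOpen d} {p : ℝ} [hp : Fact (1 < p)]
    (f : LebesgueVec Ω p) :
    MemLp (fun x => ‖f x‖ ^ (p - 1)) (ENNReal.ofReal (p / (p - 1))) Ω.measure := by
  have hp1 : 0 < p - 1 := by linarith [hp.out]
  have h := (Lp.memLp f).norm_rpow_div (ENNReal.ofReal (p - 1))
  rwa [ENNReal.toReal_ofReal hp1.le, ← ENNReal.ofReal_div_of_pos hp1] at h

theorem integrable_norm_rpow_mul_norm {Ω : BoundedOpen d} {p : ℝ} [hp : Fact (1 < p)]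
    (f g : LebesgueVec Ω p) : Integrable (fun x => ‖f x‖ ^ (p - 1) * ‖g x‖) Ω.measure := by
  have hq : (p / (p - 1)).HolderConjugate p :=
    (Real.HolderConjugate.conjExponent hp.out).symm
  have := hq.ennrealOfReal
  exact (memLp_norm_rpow_sub_one f).integrable_mul (Lp.memLp g).norm

theorem norm_pLaplacian_integrand_le {E : Type*} [NormedAddCommGroup E] [InnerProductSpace ℝ E]
    (p : ℝ) (a b : E) :
    ‖‖a‖ ^ (p - 2) * inner ℝ a b‖ ≤ ‖a‖ ^ (p - 1) * ‖b‖ := by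
  rcases eq_or_ne a 0 with rfl | ha
  · simp only [inner_zero_left, mul_zero, norm_zero]
    positivity
  · have ha' : 0 < ‖a‖ := norm_pos_iff.mpr ha
    have h1 : ‖a‖ ^ (p - 1) = ‖a‖ ^ (p - 2) * ‖a‖ := by
      rw [← Real.rpow_add_one ha'.ne']
      congr 1
      ring
    rw [norm_mul, Real.norm_of_nonneg (by positivity), h1, mul_assoc]
    gcongr
    exact norm_inner_le_norm a b

theorem integrable_pLaplacian {Ω : BoundedOpen d} {p : ℝ} [hp : Fact (1 < p)]
    (f g : LebesgueVec Ω p) :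
    Integrable (fun x => ‖f x‖ ^ (p - 2) * inner ℝ (f x) (g x)) Ω.measure := by
  refine (integrable_norm_rpow_mul_norm f g).mono' ?_
    (Filter.Eventually.of_forall fun x => norm_pLaplacian_integrand_le p (f x) (g x))
  have h1 : AEStronglyMeasurable (fun x => ‖f x‖ ^ (p - 2)) Ω.measure :=
    ((Lp.aestronglyMeasurable f).norm.aemeasurable.pow_const (p - 2)).aestronglyMeasurable
  exact h1.mul ((Lp.aestronglyMeasurable f).inner (Lp.aestronglyMeasurable g))

theorem abs_integral_pLaplacian_le {Ω : BoundedOpen d} {p : ℝ} [hp : Fact (1 < p)]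
    (f g : LebesgueVec Ω p) :
    |∫ x in Ω.carrier, ‖f x‖ ^ (p - 2) * inner ℝ (f x) (g x)| ≤ ‖f‖ ^ (p - 1) * ‖g‖ := by
  have hp1 : 0 < p - 1 := by linarith [hp.out]
  have hp0 : 0 < p := by linarith
  have hq := (Real.HolderConjugate.conjExponent hp.out).symm
  have hH := integral_mul_norm_le_Lp_mul_Lq hq (memLp_norm_rpow_sub_one f) (Lp.memLp g).norm
  have hI : 0 ≤ ∫ x in Ω.carrier, ‖f x‖ ^ p := integral_nonneg fun x => by positivity
  have h2 : ∀ x, ‖‖f x‖ ^ (p - 1)‖ ^ (p / (p - 1)) = ‖f x‖ ^ p := by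
    intro x
    rw [Real.norm_of_nonneg (by positivity), ← Real.rpow_mul (norm_nonneg _),
      mul_div_cancel₀ _ hp1.ne']
  calc |∫ x in Ω.carrier, ‖f x‖ ^ (p - 2) * inner ℝ (f x) (g x)|
      ≤ ∫ x in Ω.carrier, ‖f x‖ ^ (p - 1) * ‖g x‖ :=
        norm_integral_le_of_norm_le (integrable_norm_rpow_mul_norm f g)
          (Filter.Eventually.of_forall fun x => norm_pLaplacian_integrand_le p (f x) (g x))
    _ ≤ ‖f‖ ^ (p - 1) * ‖g‖ := by
        simp only [Real.conjExponent, h2, norm_norm] at hH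
        have h3 : ∀ x, ‖‖f x‖ ^ (p - 1)‖ = ‖f x‖ ^ (p - 1) := fun x =>
          Real.norm_of_nonneg (by positivity)
        simp only [h3] at hH
        rw [LebesgueVec.norm_eq f, LebesgueVec.norm_eq g, ← Real.rpow_mul hI]
        convert hH using 3
        field_simp

/-- The `p`-Laplacian `A : V → V*`, `⟨A u, v⟩ = ∫_Ω |∇u|^{p-2} ∇u · ∇v`, on `V = W_0^{1,p}(Ω)`. -/
def pLaplacian [NeZero d] (Ω : BoundedOpen d) (p : ℝ) [Fact (1 < p)] (u : SobolevZero Ω p) :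
    StrongDual ℝ (SobolevZero Ω p) :=
  LinearMap.mkContinuous
    { toFun := fun v => ∫ x in Ω.carrier, ‖SobolevZero.grad Ω p u x‖ ^ (p - 2) *
        inner ℝ (SobolevZero.grad Ω p u x) (SobolevZero.grad Ω p v x)
      map_add' := by
        intro v w
        rw [← integral_add (integrable_pLaplacian _ _) (integrable_pLaplacian _ _), map_add]
        refine integral_congr_ae ?_
        filter_upwards [Lp.coeFn_add (SobolevZero.grad Ω p v) (SobolevZero.grad Ω p w)] with x hx
        simp only [hx, Pi.add_apply, inner_add_right, mul_add]
      map_smul' := by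
        intro c v
        rw [map_smul, RingHom.id_apply, smul_eq_mul, ← integral_const_mul]
        refine integral_congr_ae ?_
        filter_upwards [Lp.coeFn_smul c (SobolevZero.grad Ω p v)] with x hx
        simp only [hx, Pi.smul_apply, inner_smul_right]
        ring }
    (‖u‖ ^ (p - 1)) (fun v => abs_integral_pLaplacian_le _ _)

/-- `C` is a constant in the continuity bound for the `p`-Laplacian on `W_0^{1,p}(Ω)`. -/
def IsContinuityConst [NeZero d] (Ω : BoundedOpen d) (p : ℝ) [Fact (1 < p)] (C : ℝ) : Prop :=
  ∀ u w : SobolevZero Ω p, ‖pLaplacian Ω p u - pLaplacian Ω p w‖ ≤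
    if 2 ≤ p then C * (‖u‖ + ‖w‖) ^ (p - 2) * ‖u - w‖ else C * ‖u - w‖ ^ (p - 1)

/-- `C` is a constant in the monotonicity bound for the `p`-Laplacian on `W_0^{1,p}(Ω)`. -/
def IsMonotonicityConst [NeZero d] (Ω : BoundedOpen d) (p : ℝ) [Fact (1 < p)] (C : ℝ) : Prop :=
  ∀ u w : SobolevZero Ω p,
    (if 2 ≤ p then C * ‖u - w‖ ^ p else C * (‖u‖ + ‖w‖) ^ (p - 2) * ‖u - w‖ ^ 2) ≤
      (pLaplacian Ω p u - pLaplacian Ω p w) (u - w)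

end Operator

end PLaplaceMinRes

end

namespace PLaplaceMinRes

/-! ### The Banach–Mazur constant -/

/-! Since `A u = F` and `J r = F - A uh`, the dual norm of `A u - A uh` is `‖r‖ ^ (p - 1)`.
Continuity of `A` bounds this number by the error `‖u - uh‖`, and monotonicity tested with `u - uh`
bounds the error by it. Only two of the four estimates involve `(‖u‖ + ‖uh‖) ^ (p - 2)`; there
`‖uh‖` has to be bounded by a multiple of `‖u‖ = ‖F‖ ^ (1 / (p - 1))`, and only this uses
minimality.

For `p < 2`, comparison with the competitor `0` gives `‖F - A uh‖ ≤ ‖F‖`, hence `‖A uh‖ ≤ 2 ‖F‖`.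
For `p ≥ 2` the bound is `‖A uh‖ ≤ C_BM ‖F‖` (`IsMinResSolution.norm_apply_le`). The image `A(Uh)`
is not linear, but by homogeneity it contains the ray through `A uh`, so `s ↦ ‖F - s • A uh‖` is
minimal at `s = 1`. Clarkson's inequality makes the dual norm differentiable
(`apply_nonpos_of_norm_le`), so the derivative vanishes: `A uh r = 0`. Moreover `A` is itself a
duality map (`isDualityMap_pLaplacian`), so `A uh` attains its norm at `uh`, as `F - A uh` does at
`r`. In the plane spanned by `uh` and `r`, the projection onto `r` along the kernel of `F - A uh`
has norm one, so the complementary projection has norm at most `C_BM`; testing `F` with the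
complementary part of `uh` gives the bound (`norm_le_banachMazurConst_mul`). Any duality map will do
for `J`.

The constants come from pointwise inequalities for `a ↦ ‖a‖ ^ (p - 2) • a`, integrated with Hölder
or Young inequalities; monotonicity for `p ≥ 2` comes from Clarkson's inequality and the subgradient
property of `A`. -/

/-- In the Euclidean plane an oblique projection and its complement have the same norm. In
coordinates `y - ⟪g, y⟫ e` is `g` turned by a right angle times the determinant of `e` and `y`, and
Lagrange's identity bounds that determinant by `‖e‖ ‖y‖`. -/
theorem norm_sub_inner_smul_le {e g : EuclideanSpace ℝ (Fin 2)} (h : inner ℝ g e = (1 : ℝ))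
    (y : EuclideanSpace ℝ (Fin 2)) : ‖y - (inner ℝ g y : ℝ) • e‖ ≤ ‖g‖ * ‖e‖ * ‖y‖ := by
  refine abs_le_of_sq_le_sq' ?_ (by positivity) |>.2
  rw [mul_pow, mul_pow]
  simp only [EuclideanSpace.real_norm_sq_eq, Fin.sum_univ_two, PiLp.inner_apply, PiLp.sub_apply,
    PiLp.smul_apply, smul_eq_mul, RCLike.inner_apply, conj_trivial] at h ⊢
  have h0 : y 0 - (y 0 * g 0 + y 1 * g 1) * e 0 = g 1 * (e 1 * y 0 - e 0 * y 1) := by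
    linear_combination (-y 0) * h
  have h1 : y 1 - (y 0 * g 0 + y 1 * g 1) * e 1 = -(g 0 * (e 1 * y 0 - e 0 * y 1)) := by
    linear_combination (-y 1) * h
  rw [h0, h1]
  have : 0 ≤ (g 0 ^ 2 + g 1 ^ 2) * (e 0 * y 0 + e 1 * y 1) ^ 2 := by positivity
  linear_combination this

section Plane

variable {W : Type*} [NormedAddCommGroup W] [NormedSpace ℝ W]

/-- The Euclidean estimate is transported by `T`. The factor `‖T‖` enters through `r` and `x`, the
factor `‖T⁻¹‖` through `φ` and the return to `W`, hence the square. -/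
theorem norm_sub_smul_le_of_equiv (T : W ≃L[ℝ] EuclideanSpace ℝ (Fin 2)) {φ : StrongDual ℝ W}
    {r : W} (h : φ r = 1) (x : W) :
    ‖x - φ x • r‖ ≤ (‖(T : W →L[ℝ] EuclideanSpace ℝ (Fin 2))‖ *
      ‖(T.symm : EuclideanSpace ℝ (Fin 2) →L[ℝ] W)‖) ^ 2 * (‖φ‖ * ‖r‖ * ‖x‖) := by
  set t := ‖(T : W →L[ℝ] EuclideanSpace ℝ (Fin 2))‖
  set s := ‖(T.symm : EuclideanSpace ℝ (Fin 2) →L[ℝ] W)‖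
  set ψ : StrongDual ℝ (EuclideanSpace ℝ (Fin 2)) :=
    φ.comp (T.symm : EuclideanSpace ℝ (Fin 2) →L[ℝ] W)
  set g := (InnerProductSpace.toDual ℝ (EuclideanSpace ℝ (Fin 2))).symm ψ
  have hg : ∀ y, (inner ℝ g y : ℝ) = φ (T.symm y) := fun y =>
    InnerProductSpace.toDual_symm_apply
  have hgn : ‖g‖ ≤ ‖φ‖ * s := by
    rw [LinearIsometryEquiv.norm_map]
    exact φ.opNorm_comp_le _
  have hT : ∀ z, ‖T z‖ ≤ t * ‖z‖ := (T : W →L[ℝ] EuclideanSpace ℝ (Fin 2)).le_opNorm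
  have key := norm_sub_inner_smul_le (e := T r) (g := g) (by rw [hg]; simpa using h) (T x)
  rw [hg, T.symm_apply_apply] at key
  calc ‖x - φ x • r‖ = ‖T.symm (T x - φ x • T r)‖ := by simp
    _ ≤ s * ‖T x - φ x • T r‖ :=
      (T.symm : EuclideanSpace ℝ (Fin 2) →L[ℝ] W).le_opNorm _
    _ ≤ s * (‖g‖ * ‖T r‖ * ‖T x‖) := by gcongr
    _ ≤ s * ((‖φ‖ * s) * (t * ‖r‖) * (t * ‖x‖)) := by
      gcongr
      · exact hT r
      · exact hT x
    _ = (t * s) ^ 2 * (‖φ‖ * ‖r‖ * ‖x‖) := by ring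

theorem distToEuclideanPlane_nonneg : 0 ≤ distToEuclideanPlane W :=
  Real.iInf_nonneg fun _ => by positivity

/-- A rank-one projection of norm `1` in a plane has complementary projection of norm at most the
square of the Banach–Mazur distance to the Euclidean plane. -/
theorem norm_sub_smul_le_dist (hW : Module.finrank ℝ W = 2) {φ : StrongDual ℝ W} {r : W}
    (h : φ r = 1) (hφ : ‖φ‖ * ‖r‖ ≤ 1) (x : W) :
    ‖x - φ x • r‖ ≤ distToEuclideanPlane W ^ 2 * ‖x‖ := by
  rcases eq_or_ne x 0 with rfl | hx
  · simp
  have hx : 0 < ‖x‖ := norm_pos_iff.mpr hx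
  have : FiniteDimensional ℝ W := Module.finite_of_finrank_eq_succ hW
  have : Nonempty (W ≃L[ℝ] EuclideanSpace ℝ (Fin 2)) :=
    ⟨ContinuousLinearEquiv.ofFinrankEq (by simp [hW])⟩
  -- Taking the square root removes the square around the infimum, so that it suffices to treat each
  -- `T`.
  rw [← div_le_iff₀ hx, ← Real.sqrt_le_left distToEuclideanPlane_nonneg]
  refine le_ciInf fun T => Real.sqrt_le_iff.mpr ⟨by positivity, ?_⟩
  rw [div_le_iff₀ hx]
  refine (norm_sub_smul_le_of_equiv T h x).trans ?_
  gcongr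
  exact mul_le_of_le_one_left hx.le hφ

/-- A crude bound, needed only because the real supremum of an unbounded set is `0` by convention.
The coordinates are those of a unit vector `x` with norming functional `f` and a unit vector `y` in
the kernel of `f`. -/
theorem distToEuclideanPlane_le (hW : Module.finrank ℝ W = 2) : distToEuclideanPlane W ≤ 6 := by
  have hfin : FiniteDimensional ℝ W := Module.finite_of_finrank_eq_succ hW
  have : Nontrivial W := Module.nontrivial_of_finrank_pos (R := ℝ) (by omega)
  obtain ⟨x, hx⟩ := exists_norm_eq W zero_le_one
  obtain ⟨f, hf1, hfx⟩ := exists_dual_vector ℝ x (by simp [hx])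
  have hfx : f x = 1 := by simpa [hx] using hfx
  obtain ⟨y, hy, hfy⟩ : ∃ y : W, ‖y‖ = 1 ∧ f y = 0 := by
    have hne : LinearMap.ker (f : W →ₗ[ℝ] ℝ) ≠ ⊥ :=
      LinearMap.ker_ne_bot_of_finrank_lt (by simp [hW])
    obtain ⟨y, hy, hy0⟩ := Submodule.exists_mem_ne_zero_of_ne_bot hne
    refine ⟨‖y‖⁻¹ • y, norm_smul_inv_norm hy0, ?_⟩
    rw [map_smul, show f y = 0 from hy, smul_zero]
  have hnorm : ∀ s t : ℝ, |t| ≤ 2 * ‖s • x + t • y‖ ∧ |s| ≤ ‖s • x + t • y‖ := by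
    intro s t
    have h1 : |s| ≤ ‖s • x + t • y‖ := by
      have := f.le_opNorm (s • x + t • y)
      rwa [map_add, map_smul, map_smul, hfx, hfy, hf1, smul_zero, add_zero, smul_eq_mul, mul_one,
        one_mul, Real.norm_eq_abs] at this
    refine ⟨?_, h1⟩
    have h2 : ‖t • y‖ ≤ ‖s • x + t • y‖ + ‖s • x‖ := by
      simpa using norm_sub_le (s • x + t • y) (s • x)
    rw [norm_smul, norm_smul, hx, hy, mul_one, mul_one, Real.norm_eq_abs, Real.norm_eq_abs] at h2
    linarith
  let L : EuclideanSpace ℝ (Fin 2) →ₗ[ℝ] W :=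
    { toFun := fun z => z 0 • x + z 1 • y
      map_add' := fun z z' => by simp only [PiLp.add_apply]; module
      map_smul' := fun c z => by simp only [PiLp.smul_apply, RingHom.id_apply, smul_eq_mul]; module }
  have hz : ∀ z : EuclideanSpace ℝ (Fin 2), ‖z‖ ≤ |z 0| + |z 1| := by
    intro z
    refine abs_le_of_sq_le_sq' ?_ (by positivity) |>.2
    rw [EuclideanSpace.real_norm_sq_eq, Fin.sum_univ_two, ← sq_abs (z 0), ← sq_abs (z 1)]
    nlinarith [mul_nonneg (abs_nonneg (z 0)) (abs_nonneg (z 1))]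
  have hL1 : ∀ z, ‖z‖ ≤ 3 * ‖L z‖ := fun z => by
    have := hnorm (z 0) (z 1)
    change ‖z‖ ≤ 3 * ‖z 0 • x + z 1 • y‖
    linarith [hz z]
  have hL2 : ∀ z, ‖L z‖ ≤ 2 * ‖z‖ := fun z => by
    have h := norm_add_le (z 0 • x) (z 1 • y)
    rw [norm_smul, norm_smul, hx, hy, mul_one, mul_one] at h
    change ‖z 0 • x + z 1 • y‖ ≤ 2 * ‖z‖
    linarith [PiLp.norm_apply_le z 0, PiLp.norm_apply_le z 1]
  have hinj : Function.Injective L := by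
    rw [injective_iff_map_eq_zero]
    intro z h
    have := hL1 z
    rw [h, norm_zero, mul_zero] at this
    exact norm_le_zero_iff.mp this
  let T : EuclideanSpace ℝ (Fin 2) ≃L[ℝ] W :=
    (LinearEquiv.ofInjectiveOfFinrankEq L hinj (by simp [hW])).toContinuousLinearEquiv
  have hT : ∀ z, T z = L z := fun z => rfl
  have h1 : ‖(T : EuclideanSpace ℝ (Fin 2) →L[ℝ] W)‖ ≤ 2 :=
    ContinuousLinearMap.opNorm_le_bound _ (by norm_num) hL2
  have h2 : ‖(T.symm : W →L[ℝ] EuclideanSpace ℝ (Fin 2))‖ ≤ 3 :=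
    ContinuousLinearMap.opNorm_le_bound _ (by norm_num) fun w => by
      have := hL1 (T.symm w)
      rwa [← hT, T.apply_symm_apply] at this
  refine (ciInf_le ⟨0, ?_⟩ T.symm).trans ?_
  · rintro _ ⟨S, rfl⟩
    positivity
  · rw [ContinuousLinearEquiv.symm_symm]
    calc _ ≤ (3 : ℝ) * 2 := by gcongr
      _ = 6 := by norm_num

end Plane

section Space

variable {X : Type*} [NormedAddCommGroup X] [NormedSpace ℝ X]

theorem bddAbove_sq_dist : BddAbove (insert (1 : ℝ)
    {c | ∃ W : Submodule ℝ X, Module.finrank ℝ W = 2 ∧ c = distToEuclideanPlane W ^ 2}) := by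
  refine ⟨6 ^ 2, ?_⟩
  rintro c (rfl | ⟨W, hW, rfl⟩)
  · norm_num
  · exact pow_le_pow_left₀ distToEuclideanPlane_nonneg (distToEuclideanPlane_le hW) 2

theorem one_le_banachMazurConst : 1 ≤ banachMazurConst X :=
  le_csSup bddAbove_sq_dist (mem_insert _ _)

theorem sq_dist_le_banachMazurConst {W : Submodule ℝ X} (hW : Module.finrank ℝ W = 2) :
    distToEuclideanPlane W ^ 2 ≤ banachMazurConst X :=
  le_csSup bddAbove_sq_dist (mem_insert_of_mem _ ⟨W, hW, rfl⟩)

/-- If `a` and `b` attain their norms at `w` and `r`, and `a` vanishes at `r`, then `a` is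
controlled by `a + b`. -/
theorem norm_le_banachMazurConst_mul {a b : StrongDual ℝ X} {w r : X} (hw : a w = ‖a‖ * ‖w‖)
    (hr : b r = ‖b‖ * ‖r‖) (har : a r = 0) (hw0 : w ≠ 0) (hbr : b = 0 ↔ r = 0) :
    ‖a‖ ≤ banachMazurConst X * ‖a + b‖ := by
  have hC := one_le_banachMazurConst (X := X)
  rcases eq_or_ne r 0 with h0 | h0
  · rw [hbr.mpr h0, add_zero]
    exact le_mul_of_one_le_left (norm_nonneg _) hC
  rcases eq_or_ne a 0 with rfl | ha
  · rw [norm_zero]; positivity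
  have hb0 : b ≠ 0 := fun h => h0 (hbr.mp h)
  have haw : a w ≠ 0 := by rw [hw]; simp [ha, hw0]
  have hbr0 : b r ≠ 0 := by rw [hr]; simp [hb0, h0]
  have hli : LinearIndependent ℝ ![w, r] := by
    rw [LinearIndependent.pair_iff]
    intro s t hst
    have hs : s = 0 := by
      have := congrArg a hst
      simpa [har, haw] using this
    subst hs
    simpa [h0] using hst
  let W : Submodule ℝ X := Submodule.span ℝ (range ![w, r])
  have hW : Module.finrank ℝ W = 2 := by
    simpa using finrank_span_eq_card hli
  let w' : W := ⟨w, Submodule.subset_span ⟨0, rfl⟩⟩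
  let r' : W := ⟨r, Submodule.subset_span ⟨1, rfl⟩⟩
  let φ : StrongDual ℝ W := (b r)⁻¹ • b.comp W.subtypeL
  have hφr : φ r' = 1 := inv_mul_cancel₀ hbr0
  have hφn : ‖φ‖ * ‖r'‖ ≤ 1 := by
    have h1 : ‖φ‖ ≤ (‖b‖ * ‖r‖)⁻¹ * ‖b‖ := by
      refine ContinuousLinearMap.opNorm_le_bound _ (by positivity) fun z => ?_
      change ‖(b r)⁻¹ * b z‖ ≤ _
      rw [norm_mul, norm_inv, hr, mul_assoc, Real.norm_of_nonneg (by positivity)]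
      gcongr
      exact b.le_opNorm _
    have hrn : ‖r‖ ≠ 0 := norm_ne_zero_iff.mpr h0
    have hbn : ‖b‖ ≠ 0 := norm_ne_zero_iff.mpr hb0
    calc ‖φ‖ * ‖r'‖ ≤ (‖b‖ * ‖r‖)⁻¹ * ‖b‖ * ‖r‖ := by gcongr; rfl
      _ = 1 := by field_simp
  have hz : ‖w - φ w' • r‖ ≤ distToEuclideanPlane W ^ 2 * ‖w‖ :=
    norm_sub_smul_le_dist hW hφr hφn w'
  have hφw : φ w' = (b r)⁻¹ * b w := rfl
  -- The vector `w - φ w' • r` lies in the kernel of `b` by the choice of `φ`, and `a` does not see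
  -- `r`.
  have hval : (a + b) (w - φ w' • r) = ‖a‖ * ‖w‖ := by
    rw [← hw, hφw]
    simp only [map_sub, map_smul, add_apply, har, smul_eq_mul]
    field_simp
    ring
  have hwp : 0 < ‖w‖ := norm_pos_iff.mpr hw0
  refine le_of_mul_le_mul_right ?_ hwp
  calc ‖a‖ * ‖w‖ ≤ ‖a + b‖ * ‖w - φ w' • r‖ := by
        rw [← hval]; exact (le_abs_self _).trans ((a + b).le_opNorm _)
    _ ≤ ‖a + b‖ * (banachMazurConst X * ‖w‖) := by
        gcongr
        exact hz.trans (by gcongr; exact sq_dist_le_banachMazurConst hW)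
    _ = banachMazurConst X * ‖a + b‖ * ‖w‖ := by ring

end Space

/-! ### Elementary inequalities -/

theorem rpow_sub_two_mul_self {p x : ℝ} (hp : 1 < p) (hx : 0 ≤ x) :
    x ^ (p - 2) * x = x ^ (p - 1) := by
  rcases hx.eq_or_lt with rfl | hx
  · rw [mul_zero, Real.zero_rpow (by linarith)]
  · rw [← Real.rpow_add_one hx.ne']
    congr 1
    ring

/-- The convex power lies above its tangent at `x`; this is Bernoulli's inequality for `y / x - 1`.
-/
theorem rpow_add_mul_sub_le {q x y : ℝ} (hq : 1 ≤ q) (hx : 0 < x) (hy : 0 ≤ y) :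
    x ^ q + q * x ^ (q - 1) * (y - x) ≤ y ^ q := by
  have h := one_add_mul_self_le_rpow_one_add (s := y / x - 1) (by
    have : 0 ≤ y / x := by positivity
    linarith) hq
  rw [add_sub_cancel, Real.div_rpow hy hx.le, le_div_iff₀ (by positivity)] at h
  rw [Real.rpow_sub_one hx.ne']
  have : x ^ q / x * x = x ^ q := div_mul_cancel₀ _ hx.ne'
  linear_combination h - q * this

theorem rpow_le_rpow_add_mul_sub {q x y : ℝ} (hq0 : 0 ≤ q) (hq : q ≤ 1) (hx : 0 < x)
    (hy : 0 ≤ y) : y ^ q ≤ x ^ q + q * x ^ (q - 1) * (y - x) := by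
  have h := rpow_one_add_le_one_add_mul_self (s := y / x - 1) (by
    have : 0 ≤ y / x := by positivity
    linarith) hq0 hq
  rw [add_sub_cancel, Real.div_rpow hy hx.le, div_le_iff₀ (by positivity)] at h
  rw [Real.rpow_sub_one hx.ne']
  have : x ^ q / x * x = x ^ q := div_mul_cancel₀ _ hx.ne'
  linear_combination h + q * this

/-! ### Pointwise inequalities for the vector field `a ↦ ‖a‖ ^ (p - 2) • a` -/

section Pointwise

variable {E : Type*} [NormedAddCommGroup E] [InnerProductSpace ℝ E] {p : ℝ}

/-- Clarkson's inequality in an inner product space. -/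
theorem clarkson_inner (hp : 2 ≤ p) (a b : E) :
    ‖a + b‖ ^ p + ‖a - b‖ ^ p ≤ 2 ^ (p - 1) * (‖a‖ ^ p + ‖b‖ ^ p) := by
  have hsq : ∀ x : E, ‖x‖ ^ p = (‖x‖ ^ 2) ^ (p / 2) := fun x => by
    rw [← Real.rpow_natCast, ← Real.rpow_mul (norm_nonneg _)]
    congr 1
    push_cast
    ring
  have hq : 1 ≤ p / 2 := by linarith
  have hpar : ‖a + b‖ ^ 2 + ‖a - b‖ ^ 2 = 2 * (‖a‖ ^ 2 + ‖b‖ ^ 2) := by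
    have := parallelogram_law_with_norm ℝ a b
    linarith
  rw [hsq, hsq, hsq, hsq]
  -- Superadditivity of `t ^ (p / 2)`, then the parallelogram law, then convexity of the same power.
  calc (‖a + b‖ ^ 2) ^ (p / 2) + (‖a - b‖ ^ 2) ^ (p / 2)
      ≤ (‖a + b‖ ^ 2 + ‖a - b‖ ^ 2) ^ (p / 2) :=
        Real.add_rpow_le_rpow_add (by positivity) (by positivity) hq
    _ = 2 ^ (p / 2) * (‖a‖ ^ 2 + ‖b‖ ^ 2) ^ (p / 2) := by
        rw [hpar, Real.mul_rpow (by norm_num) (by positivity)]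
    _ ≤ 2 ^ (p / 2) * (2 ^ (p / 2 - 1) * ((‖a‖ ^ 2) ^ (p / 2) + (‖b‖ ^ 2) ^ (p / 2))) := by
        gcongr
        exact NNReal.rpow_add_le_mul_rpow_add_rpow (‖a‖₊ ^ 2) (‖b‖₊ ^ 2) hq
    _ = 2 ^ (p - 1) * ((‖a‖ ^ 2) ^ (p / 2) + (‖b‖ ^ 2) ^ (p / 2)) := by
        rw [← mul_assoc, ← Real.rpow_add (by norm_num)]
        congr 2
        ring

/-- With `‖b‖ ≤ ‖a‖`, the difference splits into `‖a‖ ^ (p - 2) • (a - b)` and a multiple of `b`.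
The tangent of `t ^ (p - 1)` at `‖a‖` bounds the second part with factor `p - 1`, so the constants
add up to `p`. -/
theorem norm_rpow_smul_sub_le_of_two_le (hp : 2 ≤ p) (a b : E) :
    ‖‖a‖ ^ (p - 2) • a - ‖b‖ ^ (p - 2) • b‖ ≤ p * (‖a‖ + ‖b‖) ^ (p - 2) * ‖a - b‖ := by
  wlog hab : ‖b‖ ≤ ‖a‖ generalizing a b
  · rw [norm_sub_rev, norm_sub_rev a, add_comm]
    exact this b a (le_of_not_ge hab)
  rcases (norm_nonneg a).eq_or_lt with h0 | h0
  · have hb : b = 0 := norm_le_zero_iff.mp (hab.trans h0.symm.le)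
    have ha : a = 0 := norm_eq_zero.mp h0.symm
    simp [ha, hb]
  have hmono : ‖b‖ ^ (p - 2) ≤ ‖a‖ ^ (p - 2) :=
    Real.rpow_le_rpow (norm_nonneg _) hab (by linarith)
  have htan := rpow_add_mul_sub_le (q := p - 1) (by linarith) h0 (norm_nonneg b)
  rw [show p - 1 - 1 = p - 2 by ring] at htan
  have hA := rpow_sub_two_mul_self (p := p) (by linarith) h0.le
  have hB := rpow_sub_two_mul_self (p := p) (by linarith) (norm_nonneg b)
  have hsub : ‖a‖ - ‖b‖ ≤ ‖a - b‖ := norm_sub_norm_le a b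
  have hx : 0 ≤ ‖a‖ ^ (p - 2) := by positivity
  calc ‖‖a‖ ^ (p - 2) • a - ‖b‖ ^ (p - 2) • b‖
      = ‖‖a‖ ^ (p - 2) • (a - b) + (‖a‖ ^ (p - 2) - ‖b‖ ^ (p - 2)) • b‖ := by
        congr 1
        module
    _ ≤ ‖a‖ ^ (p - 2) * ‖a - b‖ + (‖a‖ ^ (p - 2) - ‖b‖ ^ (p - 2)) * ‖b‖ := by
        refine (norm_add_le _ _).trans_eq ?_
        rw [norm_smul, norm_smul, Real.norm_of_nonneg hx, Real.norm_of_nonneg (by linarith)]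
    _ ≤ ‖a‖ ^ (p - 2) * ‖a - b‖ + (p - 1) * ‖a‖ ^ (p - 2) * (‖a‖ - ‖b‖) := by
        have : ‖a‖ ^ (p - 2) * ‖b‖ ≤ ‖a‖ ^ (p - 2) * ‖a‖ := by gcongr
        linarith
    _ ≤ ‖a‖ ^ (p - 2) * ‖a - b‖ + (p - 1) * ‖a‖ ^ (p - 2) * ‖a - b‖ := by
        have : 0 ≤ (p - 1) * ‖a‖ ^ (p - 2) := mul_nonneg (by linarith) hx
        gcongr
    _ = p * ‖a‖ ^ (p - 2) * ‖a - b‖ := by ring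
    _ ≤ p * (‖a‖ + ‖b‖) ^ (p - 2) * ‖a - b‖ := by
        gcongr
        exact le_add_of_nonneg_right (norm_nonneg b)

theorem norm_rpow_smul_sub_le_of_lt_two (hp1 : 1 < p) (hp : p < 2) (a b : E) :
    ‖‖a‖ ^ (p - 2) • a - ‖b‖ ^ (p - 2) • b‖ ≤ 4 * ‖a - b‖ ^ (p - 1) := by
  wlog hab : ‖b‖ ≤ ‖a‖ generalizing a b
  · rw [norm_sub_rev, norm_sub_rev a]
    exact this b a (le_of_not_ge hab)
  rcases (norm_nonneg b).eq_or_lt with hb0 | hb0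
  · have hb : b = 0 := norm_eq_zero.mp hb0.symm
    rw [hb, smul_zero, sub_zero, sub_zero, norm_smul, Real.norm_of_nonneg (by positivity),
      rpow_sub_two_mul_self hp1 (norm_nonneg a)]
    have : 0 ≤ ‖a‖ ^ (p - 1) := by positivity
    linarith
  have ha0 : 0 < ‖a‖ := hb0.trans_le hab
  rcases (norm_nonneg (a - b)).eq_or_lt with h0 | h0
  · have hab' : a = b := sub_eq_zero.mp (norm_eq_zero.mp h0.symm)
    rw [hab', sub_self, norm_zero]
    positivity
  have hanti : ‖a‖ ^ (p - 2) ≤ ‖b‖ ^ (p - 2) :=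
    Real.rpow_le_rpow_of_nonpos hb0 hab (by linarith)
  have hA := rpow_sub_two_mul_self hp1 ha0.le
  have hB := rpow_sub_two_mul_self hp1 hb0.le
  have hmono : ‖b‖ ^ (p - 1) ≤ ‖a‖ ^ (p - 1) := Real.rpow_le_rpow hb0.le hab (by linarith)
  have hsub : ‖a‖ - ‖b‖ ≤ ‖a - b‖ := norm_sub_norm_le a b
  have htri : ‖a - b‖ ≤ 2 * ‖a‖ := by linarith [norm_sub_le a b]
  have hx : 0 ≤ ‖a‖ ^ (p - 2) := by positivity
  have hhalf : (2 : ℝ) ^ (2 - p) ≤ 2 := by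
    simpa using Real.rpow_le_rpow_of_exponent_le (x := 2) one_le_two (show 2 - p ≤ 1 by linarith)
  -- From `‖a - b‖ ≤ 2 ‖a‖`, since the exponent is negative. Both parts of the splitting below are
  -- at most `‖a‖ ^ (p - 2) * ‖a - b‖`, which gives `4 = 2 + 2`.
  have hpow : ‖a‖ ^ (p - 2) ≤ 2 * ‖a - b‖ ^ (p - 2) := by
    calc ‖a‖ ^ (p - 2) ≤ (‖a - b‖ / 2) ^ (p - 2) :=
          Real.rpow_le_rpow_of_nonpos (by positivity) (by linarith) (by linarith)
      _ = 2 ^ (2 - p) * ‖a - b‖ ^ (p - 2) := by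
          rw [Real.div_rpow h0.le (by norm_num), show 2 - p = -(p - 2) by ring,
            Real.rpow_neg (by norm_num)]
          ring
      _ ≤ 2 * ‖a - b‖ ^ (p - 2) := by gcongr
  calc ‖‖a‖ ^ (p - 2) • a - ‖b‖ ^ (p - 2) • b‖
      = ‖‖a‖ ^ (p - 2) • (a - b) - (‖b‖ ^ (p - 2) - ‖a‖ ^ (p - 2)) • b‖ := by
        congr 1
        module
    _ ≤ ‖a‖ ^ (p - 2) * ‖a - b‖ + (‖b‖ ^ (p - 2) - ‖a‖ ^ (p - 2)) * ‖b‖ := by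
        refine (norm_sub_le _ _).trans_eq ?_
        rw [norm_smul, norm_smul, Real.norm_of_nonneg hx, Real.norm_of_nonneg (by linarith)]
    _ ≤ ‖a‖ ^ (p - 2) * ‖a - b‖ + ‖a‖ ^ (p - 2) * (‖a‖ - ‖b‖) := by linarith
    _ ≤ ‖a‖ ^ (p - 2) * ‖a - b‖ + ‖a‖ ^ (p - 2) * ‖a - b‖ := by gcongr
    _ ≤ 2 * ‖a - b‖ ^ (p - 2) * ‖a - b‖ + 2 * ‖a - b‖ ^ (p - 2) * ‖a - b‖ := by gcongr
    _ = 4 * ‖a - b‖ ^ (p - 1) := by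
        rw [← rpow_sub_two_mul_self hp1 h0.le]
        ring

/-- For fixed norms both sides are affine in `t = ⟪a, b⟫`, so the extreme values `t = ±‖a‖ ‖b‖`
suffice. These are one-dimensional: parallel vectors use the tangent of the concave power,
antiparallel ones its subadditivity. -/
theorem inner_rpow_smul_sub_ge_of_lt_two (hp1 : 1 < p) (hp : p < 2) (a b : E) :
    (p - 1) * ((‖a‖ + ‖b‖) ^ (p - 2) * ‖a - b‖ ^ 2) ≤
      ‖a‖ ^ (p - 2) * inner ℝ a (a - b) - ‖b‖ ^ (p - 2) * inner ℝ b (a - b) := by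
  wlog hab : ‖b‖ ≤ ‖a‖ generalizing a b
  · have := this b a (le_of_not_ge hab)
    rw [norm_sub_rev, add_comm, ← neg_sub a b, inner_neg_right, inner_neg_right] at this
    linarith
  rw [norm_sub_sq_real, inner_sub_right, inner_sub_right, real_inner_self_eq_norm_sq,
    real_inner_self_eq_norm_sq, real_inner_comm a b]
  have ht := abs_le.mp (abs_real_inner_le_norm a b)
  set t : ℝ := inner ℝ a b
  rcases (norm_nonneg b).eq_or_lt with hb0 | hb0
  · have h0 : t = 0 := by
      rw [← hb0, mul_zero] at ht
      linarith
    rw [h0, ← hb0]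
    have : 0 ≤ ‖a‖ ^ (p - 2) * ‖a‖ ^ 2 := by positivity
    simp only [add_zero]
    nlinarith
  have ha0 : 0 < ‖a‖ := hb0.trans_le hab
  have hS0 : 0 < ‖a‖ + ‖b‖ := by positivity
  have hA := rpow_sub_two_mul_self hp1 ha0.le
  have hB := rpow_sub_two_mul_self hp1 hb0.le
  have hS := rpow_sub_two_mul_self hp1 hS0.le
  have htan := rpow_le_rpow_add_mul_sub (q := p - 1) (by linarith) (by linarith) ha0 hb0.le
  rw [show p - 1 - 1 = p - 2 by ring] at htan
  have hadd := Real.rpow_add_le_add_rpow ha0.le hb0.le (p := p - 1) (by linarith) (by linarith)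
  have hxS : (‖a‖ + ‖b‖) ^ (p - 2) ≤ ‖a‖ ^ (p - 2) :=
    Real.rpow_le_rpow_of_nonpos ha0 (by linarith) (by linarith)
  have hK0 : 0 ≤ (‖a‖ + ‖b‖) ^ (p - 2) := by positivity
  rw [← hA, ← hB] at htan
  rw [← hA, ← hB, ← hS] at hadd
  clear hA hB hS
  generalize ‖a‖ ^ (p - 2) = x at *
  generalize ‖b‖ ^ (p - 2) = y at *
  generalize (‖a‖ + ‖b‖) ^ (p - 2) = k at *
  generalize ‖a‖ = α at *
  generalize ‖b‖ = β at *
  have hG1 : 0 ≤ (x * α - y * β) * (α - β) - (p - 1) * k * (α - β) ^ 2 := by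
    have h1 : (p - 1) * k * (α - β) ≤ (p - 1) * x * (α - β) := by
      have : 0 ≤ p - 1 := by linarith
      have : 0 ≤ α - β := by linarith
      gcongr
    have h2 : (p - 1) * k * (α - β) ≤ x * α - y * β := by linarith
    have h3 := mul_le_mul_of_nonneg_right h2 (show 0 ≤ α - β by linarith)
    linarith
  have hG2 : 0 ≤ (x * α + y * β) * (α + β) - (p - 1) * k * (α + β) ^ 2 := by
    have h1 : (p - 1) * (k * (α + β)) ≤ 1 * (k * (α + β)) := by
      gcongr
      linarith
    have h2 : (p - 1) * (k * (α + β)) ≤ x * α + y * β := by linarith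
    have h3 := mul_le_mul_of_nonneg_right h2 hS0.le
    linarith
  have h1 := mul_nonneg (show 0 ≤ α * β + t by linarith) hG1
  have h2 := mul_nonneg (show 0 ≤ α * β - t by linarith) hG2
  rw [← sub_nonneg]
  -- Affine interpolation between the endpoints with weights `αβ + t` and `αβ - t`, whose sum is
  -- `2αβ`.
  refine le_of_mul_le_mul_left ?_ (show 0 < 2 * (α * β) by positivity)
  rw [mul_zero]
  linear_combination h1 + h2

end Pointwise

/-! ### Residual minimization in a space with Clarkson's inequality -/

section Abstract

open Filter Topology

variable {X : Type*} [NormedAddCommGroup X] [NormedSpace ℝ X] {p : ℝ}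

theorem exists_norm_le_one_sub_le (f : StrongDual ℝ X) {ε : ℝ} (hε : 0 < ε) :
    ∃ x : X, ‖x‖ ≤ 1 ∧ ‖f‖ - ε ≤ f x := by
  obtain ⟨x, hx, hfx⟩ := f.exists_lt_apply_of_lt_opNorm (show ‖f‖ - ε < ‖f‖ by linarith)
  rcases le_total 0 (f x) with h | h
  · rw [Real.norm_of_nonneg h] at hfx
    exact ⟨x, hx.le, hfx.le⟩
  · rw [Real.norm_of_nonpos h] at hfx
    exact ⟨-x, by simpa using hx.le, by simpa using hfx.le⟩

/-- If the norm of `R` does not decrease in the direction `-a`, then `a` is nonpositive at the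
point where `R` attains its norm. -/
theorem apply_nonpos_of_norm_le (hp : 0 < p)
    (hX : ∀ x y : X, ‖x + y‖ ^ p + ‖x - y‖ ^ p ≤ 2 ^ (p - 1) * (‖x‖ ^ p + ‖y‖ ^ p))
    {R a : StrongDual ℝ X} {e : X} (hR : R ≠ 0) (he : ‖e‖ = 1) (hRe : R e = ‖R‖)
    (hmin : ∀ δ : ℝ, 0 < δ → δ ≤ 1 → ‖R‖ ≤ ‖R - δ • a‖) : a e ≤ 0 := by
  have hR0 : 0 < ‖R‖ := norm_pos_iff.mpr hR
  let δ : ℕ → ℝ := fun n => 1 / (n + 1)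
  have hδ : ∀ n, 0 < δ n := fun n => Nat.one_div_pos_of_nat
  have hδ1 : ∀ n, δ n ≤ 1 := fun n => by
    rw [div_le_one (by positivity)]
    linarith [Nat.cast_nonneg (α := ℝ) n]
  have hδlim : Tendsto δ atTop (𝓝 0) := tendsto_one_div_add_atTop_nhds_zero_nat
  -- Almost norming vectors for `R - δ n • a`. The tolerance `δ n ^ 2` is still small after division
  -- by `δ n`, which gives `a (x n) ≤ δ n`.
  choose x hx1 hx using fun n => exists_norm_le_one_sub_le (R - δ n • a)
    (show 0 < δ n ^ 2 by have := hδ n; positivity)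
  have hxR : ∀ n, ‖R‖ - δ n ^ 2 ≤ R (x n) - δ n * a (x n) := fun n => by
    have h1 := hx n
    have h2 := hmin _ (hδ n) (hδ1 n)
    rw [sub_apply, smul_apply, smul_eq_mul] at h1
    linarith
  have hRx : ∀ n, R (x n) ≤ ‖R‖ := fun n =>
    (le_abs_self _).trans (R.unit_le_opNorm _ (hx1 n))
  have hax : ∀ n, |a (x n)| ≤ ‖a‖ := fun n => a.unit_le_opNorm _ (hx1 n)
  have ha : ∀ n, a (x n) ≤ δ n := fun n => by
    refine le_of_mul_le_mul_left ?_ (hδ n)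
    linarith [hxR n, hRx n]
  let K := (1 + ‖a‖) / ‖R‖
  have hnear : ∀ n, 2 - δ n * K ≤ ‖x n + e‖ := fun n => by
    have h1 : R (x n) + ‖R‖ ≤ ‖R‖ * ‖x n + e‖ := by
      rw [← hRe, ← map_add, hRe]
      exact (le_abs_self _).trans (R.le_opNorm _)
    have h2 : δ n * |a (x n)| ≤ δ n * ‖a‖ := mul_le_mul_of_nonneg_left (hax n) (hδ n).le
    have h3 : -(δ n * |a (x n)|) ≤ δ n * a (x n) := by
      rw [← mul_neg]
      exact mul_le_mul_of_nonneg_left (neg_abs_le _) (hδ n).le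
    have h4 : δ n ^ 2 ≤ δ n := by nlinarith [hδ n, hδ1 n]
    refine le_of_mul_le_mul_left ?_ hR0
    have h5 : ‖R‖ * (2 - δ n * K) = 2 * ‖R‖ - δ n * (1 + ‖a‖) := by
      simp only [K]
      field_simp
    rw [h5]
    linarith [hxR n]
  -- Clarkson's inequality as uniform convexity: `‖x n + e‖` is close to `2`, so `x n` is close to
  -- `e`. The maximum with `0` keeps the base of the power nonnegative while `δ n * K` may exceed
  -- `2`.
  have hdist : ∀ n, ‖x n - e‖ ≤ (2 ^ p - (max 0 (2 - δ n * K)) ^ p) ^ (1 / p) := fun n => by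
    have h1 : (max 0 (2 - δ n * K)) ^ p ≤ ‖x n + e‖ ^ p :=
      Real.rpow_le_rpow (le_max_left _ _) (max_le (norm_nonneg _) (hnear n)) hp.le
    have h2 : ‖x n‖ ^ p ≤ 1 := Real.rpow_le_one (norm_nonneg _) (hx1 n) hp.le
    have h3 : (2 : ℝ) ^ (p - 1) * (‖x n‖ ^ p + ‖e‖ ^ p) ≤ 2 ^ p := by
      rw [he, Real.one_rpow]
      calc (2 : ℝ) ^ (p - 1) * (‖x n‖ ^ p + 1) ≤ 2 ^ (p - 1) * (1 + 1) := by gcongr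
        _ = 2 ^ p := by
          rw [one_add_one_eq_two, ← Real.rpow_add_one (by norm_num), sub_add_cancel]
    have h4 : ‖x n - e‖ ^ p ≤ 2 ^ p - (max 0 (2 - δ n * K)) ^ p := by
      linarith [hX (x n) e]
    rw [one_div]
    exact (Real.le_rpow_inv_iff_of_pos (norm_nonneg _)
      ((Real.rpow_nonneg (norm_nonneg _) _).trans h4) hp).mpr h4
  have hlim : Tendsto (fun n => (2 ^ p - (max 0 (2 - δ n * K)) ^ p) ^ (1 / p)) atTop (𝓝 0) := by
    have h1 : Tendsto (fun n => max 0 (2 - δ n * K)) atTop (𝓝 2) := by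
      simpa using tendsto_const_nhds (x := (0 : ℝ)).max
        ((tendsto_const_nhds (x := (2 : ℝ))).sub (hδlim.mul_const K))
    have h2 := (tendsto_const_nhds (x := (2 : ℝ) ^ p)).sub (h1.rpow_const (Or.inr hp.le))
    have h3 := h2.rpow_const (p := 1 / p) (Or.inr (by positivity))
    rwa [sub_self, Real.zero_rpow (by positivity)] at h3
  have hxe : Tendsto x atTop (𝓝 e) :=
    tendsto_iff_norm_sub_tendsto_zero.mpr (squeeze_zero (fun _ => norm_nonneg _) hdist hlim)
  exact le_of_tendsto_of_tendsto ((a.continuous.tendsto e).comp hxe) hδlim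
    (Eventually.of_forall ha)

theorem IsMinResSolution.norm_le {A : X → StrongDual ℝ X} {F : StrongDual ℝ X}
    {Uh : Submodule ℝ X} {uh : X} (hp : 1 < p) (h : IsMinResSolution p A F Uh uh) {w : X}
    (hw : w ∈ Uh) : ‖F - A uh‖ ≤ ‖F - A w‖ := by
  have hq : 0 < p / (p - 1) := div_pos (by linarith) (by linarith)
  have h1 : 1 / (p / (p - 1)) * ‖F - A uh‖ ^ (p / (p - 1)) ≤
      1 / (p / (p - 1)) * ‖F - A w‖ ^ (p / (p - 1)) := h.2 hw
  exact (Real.rpow_le_rpow_iff (norm_nonneg _) (norm_nonneg _) hq).mp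
    (le_of_mul_le_mul_left h1 (by positivity))

/-- The image of a residual minimizer under a duality map is controlled by the data. -/
theorem IsMinResSolution.norm_apply_le {A J : X → StrongDual ℝ X} {F : StrongDual ℝ X}
    {Uh : Submodule ℝ X} {uh r : X} (hp : 1 < p) (h : IsMinResSolution p A F Uh uh)
    (hX : ∀ x y : X, ‖x + y‖ ^ p + ‖x - y‖ ^ p ≤ 2 ^ (p - 1) * (‖x‖ ^ p + ‖y‖ ^ p))
    (hA : IsDualityMap p A) (hhom : ∀ (t : ℝ) (x : X), 0 ≤ t → A (t • x) = t ^ (p - 1) • A x)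
    (hJ : IsDualityMap p J) (hr : J r = F - A uh) :
    ‖A uh‖ ≤ banachMazurConst X * ‖F‖ := by
  have hp1 : p - 1 ≠ 0 := by linarith
  rcases eq_or_ne uh 0 with rfl | huh
  · rw [(hA 0).2, norm_zero, Real.zero_rpow hp1]
    have := one_le_banachMazurConst (X := X)
    positivity
  have hb : F - A uh = 0 ↔ r = 0 := by
    rw [← norm_eq_zero, ← hr, (hJ r).2, Real.rpow_eq_zero (norm_nonneg _) hp1, norm_eq_zero]
  -- By homogeneity `s • A uh` is the image of `s ^ (1 / (p - 1)) • uh`, which lies in `Uh`. Taking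
  -- `s = 1 ± δ` below gives both signs of the derivative.
  have hscale : ∀ s : ℝ, 0 ≤ s → ‖F - A uh‖ ≤ ‖F - s • A uh‖ := fun s hs => by
    have := h.norm_le hp (Uh.smul_mem (s ^ (p - 1)⁻¹) h.1)
    rwa [hhom _ _ (by positivity), Real.rpow_inv_rpow hs hp1] at this
  have har : A uh r = 0 := by
    rcases eq_or_ne r 0 with rfl | hr0
    · exact map_zero _
    have hrn : 0 < ‖r‖ := norm_pos_iff.mpr hr0
    have he : ‖‖r‖⁻¹ • r‖ = 1 := norm_smul_inv_norm hr0
    have hRe : (F - A uh) (‖r‖⁻¹ • r) = ‖F - A uh‖ := by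
      rw [map_smul, ← hr, (hJ r).1, smul_eq_mul]
      field_simp
    have hR0 : F - A uh ≠ 0 := fun h0 => hr0 (hb.mp h0)
    have h1 : A uh (‖r‖⁻¹ • r) ≤ 0 := by
      refine apply_nonpos_of_norm_le (by linarith) hX hR0 he hRe fun δ hδ _ => ?_
      have := hscale (1 + δ) (by linarith)
      rwa [add_smul, one_smul, ← sub_sub] at this
    have h2 : 0 ≤ A uh (‖r‖⁻¹ • r) := by
      have hneg : (-A uh) (‖r‖⁻¹ • r) ≤ 0 := by
        refine apply_nonpos_of_norm_le (by linarith) hX hR0 he hRe fun δ _ hδ1 => ?_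
        have := hscale (1 - δ) (by linarith)
        rwa [show F - A uh - δ • -A uh = F - (1 - δ) • A uh by module]
      simpa using hneg
    have h3 : ‖r‖⁻¹ * A uh r = 0 := by simpa using le_antisymm h1 h2
    simpa [hr0] using h3
  have hbr : (F - A uh) r = ‖F - A uh‖ * ‖r‖ := by rw [← hr]; exact (hJ r).1
  simpa using norm_le_banachMazurConst_mul (hA uh).1 hbr har huh hb

end Abstract

/-! ### Consequences of Clarkson's inequality for duality maps -/

section Abstract

variable {X : Type*} [NormedAddCommGroup X] [NormedSpace ℝ X] {p : ℝ} {A : X → StrongDual ℝ X}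

theorem IsDualityMap.apply_self (hA : IsDualityMap p A) (hp : 1 < p) (x : X) :
    A x x = ‖x‖ ^ p := by
  rcases (norm_nonneg x).eq_or_lt with h | h
  · rw [(hA x).1, ← h, mul_zero, Real.zero_rpow (by linarith)]
  · rw [(hA x).1, (hA x).2, ← Real.rpow_add_one h.ne', sub_add_cancel]

/-- A duality map is a subgradient of `x ↦ ‖x‖ ^ p / p`. -/
theorem IsDualityMap.norm_rpow_add_le (hA : IsDualityMap p A) (hp : 1 < p) (x y : X) :
    2 ^ p * ‖x‖ ^ p + p * 2 ^ (p - 1) * (A x y - A x x) ≤ ‖x + y‖ ^ p := by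
  rcases (norm_nonneg x).eq_or_lt with h | h
  · have hx : A x = 0 := by
      rw [← norm_eq_zero, (hA x).2, ← h, Real.zero_rpow (by linarith)]
    rw [hx, ← h, Real.zero_rpow (by linarith)]
    simp only [zero_apply, sub_zero, mul_zero, add_zero]
    positivity
  -- The tangent is taken at `2‖x‖`, the norm of `x + x`.
  have h1 := rpow_add_mul_sub_le (q := p) hp.le (show 0 < 2 * ‖x‖ by positivity)
    (norm_nonneg (x + y))
  rw [Real.mul_rpow (by norm_num) h.le, Real.mul_rpow (by norm_num) h.le] at h1
  have h2 : A x x + A x y ≤ ‖x‖ ^ (p - 1) * ‖x + y‖ := by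
    rw [← map_add, ← (hA x).2]
    exact (le_abs_self _).trans ((A x).le_opNorm _)
  have h3 : A x x = ‖x‖ ^ (p - 1) * ‖x‖ := by rw [(hA x).1, (hA x).2]
  have h4 : 0 ≤ p * 2 ^ (p - 1) := by positivity
  have h5 := mul_le_mul_of_nonneg_left h2 h4
  have h6 : p * 2 ^ (p - 1) * A x x = p * 2 ^ (p - 1) * (‖x‖ ^ (p - 1) * ‖x‖) := by rw [h3]
  linarith

/-- The two subgradient inequalities for `‖x + y‖ ^ p`, based at `2x` and at `2y`, are added and
compared with Clarkson's inequality; the excess is `‖x - y‖ ^ p`. -/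
theorem IsDualityMap.strongly_monotone (hA : IsDualityMap p A) (hp : 1 < p)
    (hX : ∀ x y : X, ‖x + y‖ ^ p + ‖x - y‖ ^ p ≤ 2 ^ (p - 1) * (‖x‖ ^ p + ‖y‖ ^ p)) (x y : X) :
    2 / (p * 2 ^ (p - 1)) * ‖x - y‖ ^ p ≤ (A x - A y) (x - y) := by
  have h1 := hA.norm_rpow_add_le hp x y
  have h2 := hA.norm_rpow_add_le hp y x
  have hC := hX x y
  have hk : (2 : ℝ) ^ p = 2 ^ (p - 1) * 2 := by
    rw [← Real.rpow_add_one (by norm_num), sub_add_cancel]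
  rw [add_comm y x] at h2
  have hpk : 0 < p * 2 ^ (p - 1) := by positivity
  rw [div_mul_eq_mul_div, div_le_iff₀ hpk]
  simp only [sub_apply, map_sub]
  rw [hk] at h1 h2
  linarith

end Abstract

/-! ### The `p`-Laplacian -/

section Operator

variable {d : ℕ} {Ω : BoundedOpen d} {p : ℝ} [hp : Fact (1 < p)]

theorem LebesgueVec.norm_rpow (f : LebesgueVec Ω p) :
    ‖f‖ ^ p = ∫ x in Ω.carrier, ‖f x‖ ^ p := by
  have hp0 : 0 < p := by linarith [hp.out]
  rw [LebesgueVec.norm_eq, ← Real.rpow_mul (integral_nonneg fun x => by positivity),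
    one_div_mul_cancel hp0.ne', Real.rpow_one]

theorem LebesgueVec.integrable_norm_rpow (f : LebesgueVec Ω p) :
    Integrable (fun x => ‖f x‖ ^ p) Ω.measure := by
  have hp0 : 0 < p := by linarith [hp.out]
  simpa [ENNReal.toReal_ofReal hp0.le] using (Lp.memLp f).integrable_norm_rpow'

theorem integral_norm_rpow_mul_norm_le (f g : LebesgueVec Ω p) :
    ∫ x in Ω.carrier, ‖f x‖ ^ (p - 1) * ‖g x‖ ≤ ‖f‖ ^ (p - 1) * ‖g‖ := by
  have hp1 : 0 < p - 1 := by linarith [hp.out]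
  have hp0 : 0 < p := by linarith
  have hH := integral_mul_norm_le_Lp_mul_Lq (Real.HolderConjugate.conjExponent hp.out).symm
    (memLp_norm_rpow_sub_one f) (Lp.memLp g).norm
  have hI : 0 ≤ ∫ x in Ω.carrier, ‖f x‖ ^ p := integral_nonneg fun x => by positivity
  have h3 : ∀ x, ‖‖f x‖ ^ (p - 1)‖ = ‖f x‖ ^ (p - 1) := fun x =>
    Real.norm_of_nonneg (by positivity)
  have h2 : ∀ x, (‖f x‖ ^ (p - 1)) ^ (p / (p - 1)) = ‖f x‖ ^ p := fun x => by
    rw [← Real.rpow_mul (norm_nonneg _), mul_div_cancel₀ _ hp1.ne']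
  simp only [Real.conjExponent, h3, h2, norm_norm] at hH
  rw [LebesgueVec.norm_eq f, LebesgueVec.norm_eq g, ← Real.rpow_mul hI]
  convert hH using 3
  field_simp

theorem LebesgueVec.clarkson (h2 : 2 ≤ p) (f g : LebesgueVec Ω p) :
    ‖f + g‖ ^ p + ‖f - g‖ ^ p ≤ 2 ^ (p - 1) * (‖f‖ ^ p + ‖g‖ ^ p) := by
  simp only [LebesgueVec.norm_rpow]
  rw [← integral_add (f + g).integrable_norm_rpow (f - g).integrable_norm_rpow,
    ← integral_add f.integrable_norm_rpow g.integrable_norm_rpow, ← integral_const_mul]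
  refine integral_mono_ae ((f + g).integrable_norm_rpow.add (f - g).integrable_norm_rpow)
    ((f.integrable_norm_rpow.add g.integrable_norm_rpow).const_mul _) ?_
  filter_upwards [Lp.coeFn_add f g, Lp.coeFn_sub f g] with x h1 h2'
  simp only [h1, h2', Pi.add_apply, Pi.sub_apply]
  exact clarkson_inner h2 (f x) (g x)

variable [NeZero d]

theorem SobolevZero.norm_grad (v : SobolevZero Ω p) : ‖SobolevZero.grad Ω p v‖ = ‖v‖ := rfl

theorem SobolevZero.clarkson (h2 : 2 ≤ p) (v w : SobolevZero Ω p) :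
    ‖v + w‖ ^ p + ‖v - w‖ ^ p ≤ 2 ^ (p - 1) * (‖v‖ ^ p + ‖w‖ ^ p) := by
  simp only [← SobolevZero.norm_grad, map_add, map_sub]
  exact LebesgueVec.clarkson h2 _ _

theorem pLaplacian_apply (u v : SobolevZero Ω p) :
    pLaplacian Ω p u v = ∫ x in Ω.carrier, ‖SobolevZero.grad Ω p u x‖ ^ (p - 2) *
      inner ℝ (SobolevZero.grad Ω p u x) (SobolevZero.grad Ω p v x) := rfl

theorem pLaplacian_apply_self (u : SobolevZero Ω p) : pLaplacian Ω p u u = ‖u‖ ^ p := by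
  rw [pLaplacian_apply, ← SobolevZero.norm_grad, LebesgueVec.norm_rpow]
  refine integral_congr_ae (Filter.Eventually.of_forall fun x => ?_)
  simp only [real_inner_self_eq_norm_sq]
  rw [sq, ← mul_assoc, rpow_sub_two_mul_self hp.out (norm_nonneg _)]
  have h := rpow_sub_two_mul_self (p := p + 1) (by linarith [hp.out])
    (norm_nonneg (SobolevZero.grad Ω p u x))
  rwa [show p + 1 - 2 = p - 1 by ring, add_sub_cancel_right] at h

/-- Hölder's inequality bounds the dual norm, and testing with `u` shows that the bound is attained.
-/
theorem isDualityMap_pLaplacian : IsDualityMap p (pLaplacian Ω p) := by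
  intro u
  have hle : ‖pLaplacian Ω p u‖ ≤ ‖u‖ ^ (p - 1) :=
    LinearMap.mkContinuous_norm_le _ (by positivity) _
  have hself : ‖u‖ ^ (p - 1) * ‖u‖ = pLaplacian Ω p u u := by
    have h := rpow_sub_two_mul_self (p := p + 1) (by linarith [hp.out]) (norm_nonneg u)
    rwa [show p + 1 - 2 = p - 1 by ring, add_sub_cancel_right, ← pLaplacian_apply_self] at h
  have heq : ‖pLaplacian Ω p u‖ = ‖u‖ ^ (p - 1) := by
    rcases (norm_nonneg u).eq_or_lt with h | h
    · refine le_antisymm hle ?_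
      rw [← h, Real.zero_rpow (by linarith [hp.out])]
      exact norm_nonneg _
    · refine le_antisymm hle (le_of_mul_le_mul_right ?_ h)
      rw [hself]
      exact (le_abs_self _).trans ((pLaplacian Ω p u).le_opNorm _)
  exact ⟨by rw [heq, hself], heq⟩

theorem pLaplacian_smul {t : ℝ} (ht : 0 ≤ t) (u : SobolevZero Ω p) :
    pLaplacian Ω p (t • u) = t ^ (p - 1) • pLaplacian Ω p u := by
  ext v
  rw [smul_apply, pLaplacian_apply, pLaplacian_apply, map_smul, smul_eq_mul,
    ← integral_const_mul]
  refine integral_congr_ae ?_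
  filter_upwards [Lp.coeFn_smul t (SobolevZero.grad Ω p u)] with x hx
  simp only [hx, Pi.smul_apply, norm_smul, real_inner_smul_left, Real.norm_of_nonneg ht]
  rw [Real.mul_rpow ht (norm_nonneg _), ← rpow_sub_two_mul_self hp.out ht]
  ring

/-! ### Continuity and monotonicity constants depending only on `p` -/

theorem pLaplacian_sub_apply (u w v : SobolevZero Ω p) :
    (pLaplacian Ω p u - pLaplacian Ω p w) v = ∫ x in Ω.carrier,
      (‖SobolevZero.grad Ω p u x‖ ^ (p - 2) *
          inner ℝ (SobolevZero.grad Ω p u x) (SobolevZero.grad Ω p v x) -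
        ‖SobolevZero.grad Ω p w x‖ ^ (p - 2) *
          inner ℝ (SobolevZero.grad Ω p w x) (SobolevZero.grad Ω p v x)) := by
  rw [sub_apply, pLaplacian_apply, pLaplacian_apply,
    integral_sub (integrable_pLaplacian _ _) (integrable_pLaplacian _ _)]

/-- A pointwise bound for the nonlinearity of the `p`-Laplacian bounds its differences in the dual
norm. -/
theorem norm_pLaplacian_sub_le {u w : SobolevZero Ω p} {h : EuclideanSpace ℝ (Fin d) → ℝ} {K : ℝ}
    (hK : 0 ≤ K)
    (hh : ∀ᵐ x ∂Ω.measure, ‖‖SobolevZero.grad Ω p u x‖ ^ (p - 2) • SobolevZero.grad Ω p u x -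
      ‖SobolevZero.grad Ω p w x‖ ^ (p - 2) • SobolevZero.grad Ω p w x‖ ≤ h x)
    (hi : ∀ v : LebesgueVec Ω p, Integrable (fun x => h x * ‖v x‖) Ω.measure ∧
      ∫ x in Ω.carrier, h x * ‖v x‖ ≤ K * ‖v‖) :
    ‖pLaplacian Ω p u - pLaplacian Ω p w‖ ≤ K := by
  refine ContinuousLinearMap.opNorm_le_bound _ hK fun v => ?_
  obtain ⟨h1, h2⟩ := hi (SobolevZero.grad Ω p v)
  rw [pLaplacian_sub_apply]
  refine (norm_integral_le_of_norm_le h1 ?_).trans h2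
  filter_upwards [hh] with x hx
  rw [← real_inner_smul_left, ← real_inner_smul_left, ← inner_sub_left]
  exact (norm_inner_le_norm _ _).trans (by gcongr)

theorem isContinuityConst_of_lt_two (h2 : p < 2) : IsContinuityConst Ω p 4 := by
  intro u w
  rw [if_neg (not_le.mpr h2)]
  set k := SobolevZero.grad Ω p (u - w) with hk
  refine norm_pLaplacian_sub_le (h := fun x => 4 * ‖k x‖ ^ (p - 1)) (by positivity) ?_ fun v => ?_
  · rw [hk, map_sub]
    filter_upwards [Lp.coeFn_sub (SobolevZero.grad Ω p u) (SobolevZero.grad Ω p w)] with x hx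
    rw [hx]
    exact norm_rpow_smul_sub_le_of_lt_two hp.out h2 _ _
  · simp only [mul_assoc]
    refine ⟨(integrable_norm_rpow_mul_norm k v).const_mul 4, ?_⟩
    rw [integral_const_mul]
    gcongr
    exact integral_norm_rpow_mul_norm_le k v

/-- An additive substitute for a three-factor Hölder inequality: each number is replaced by the
largest one. After rescaling by the norms, each summand needs only the two-factor inequality. -/
theorem add_rpow_mul_le {q a b c : ℝ} (hq : 2 ≤ q) (ha : 0 ≤ a) (hb : 0 ≤ b) (hc : 0 ≤ c) :
    (a + b) ^ (q - 2) * c ≤ 2 ^ (q - 2) * (a ^ (q - 1) + b ^ (q - 1) + c ^ (q - 1)) := by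
  obtain ⟨m, hm, ham, hbm, hcm, hle⟩ : ∃ m : ℝ, 0 ≤ m ∧ a ≤ m ∧ b ≤ m ∧ c ≤ m ∧
      m ^ (q - 1) ≤ a ^ (q - 1) + b ^ (q - 1) + c ^ (q - 1) := by
    have h1 : 0 ≤ a ^ (q - 1) := by positivity
    have h2 : 0 ≤ b ^ (q - 1) := by positivity
    have h3 : 0 ≤ c ^ (q - 1) := by positivity
    rcases le_total a b with hab | hab <;> rcases le_total a c with hac | hac <;>
      rcases le_total b c with hbc | hbc
    all_goals first
      | exact ⟨a, ha, by linarith, by linarith, by linarith, by linarith⟩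
      | exact ⟨b, hb, by linarith, by linarith, by linarith, by linarith⟩
      | exact ⟨c, hc, by linarith, by linarith, by linarith, by linarith⟩
  calc (a + b) ^ (q - 2) * c ≤ (2 * m) ^ (q - 2) * m := by
        gcongr
        linarith
    _ = 2 ^ (q - 2) * m ^ (q - 1) := by
        rw [Real.mul_rpow (by norm_num) hm, mul_assoc, rpow_sub_two_mul_self (by linarith) hm]
    _ ≤ _ := by gcongr

theorem add_rpow_mul_le_scaled {q a b c σ δ : ℝ} (hq : 2 ≤ q) (ha : 0 ≤ a) (hb : 0 ≤ b)
    (hc : 0 ≤ c) (hσ : 0 < σ) (hδ : 0 < δ) :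
    (a + b) ^ (q - 2) * c ≤ 2 ^ (q - 2) * (σ ^ (q - 2) * δ) *
      ((σ ^ (q - 1))⁻¹ * a ^ (q - 1) + (σ ^ (q - 1))⁻¹ * b ^ (q - 1) +
        (δ ^ (q - 1))⁻¹ * c ^ (q - 1)) := by
  have h := add_rpow_mul_le hq (div_nonneg ha hσ.le) (div_nonneg hb hσ.le) (div_nonneg hc hδ.le)
  rw [← add_div, Real.div_rpow (by positivity) hσ.le, Real.div_rpow ha hσ.le,
    Real.div_rpow hb hσ.le, Real.div_rpow hc hδ.le] at h
  have h' := mul_le_mul_of_nonneg_left h (show 0 ≤ σ ^ (q - 2) * δ by positivity)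
  have hσ' : σ ^ (q - 2) ≠ 0 := by positivity
  calc (a + b) ^ (q - 2) * c = σ ^ (q - 2) * δ * ((a + b) ^ (q - 2) / σ ^ (q - 2) * (c / δ)) := by
        field_simp
    _ ≤ _ := h'
    _ = _ := by ring

theorem isContinuityConst_of_two_le (h2 : 2 ≤ p) :
    IsContinuityConst Ω p (p * 2 ^ (p - 2) * 3) := by
  intro u w
  rw [if_pos h2]
  rcases (norm_nonneg (u - w)).eq_or_lt with h0 | hδ
  · have : u = w := sub_eq_zero.mp (norm_eq_zero.mp h0.symm)
    simp [this]
  have hσ : 0 < ‖u‖ + ‖w‖ := hδ.trans_le (norm_sub_le u w)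
  set k := SobolevZero.grad Ω p (u - w) with hk
  set f := SobolevZero.grad Ω p u
  set g := SobolevZero.grad Ω p w
  set σ := ‖u‖ + ‖w‖
  set δ := ‖u - w‖
  have hp0 : 0 < p := by linarith
  let M := p * 2 ^ (p - 2) * (σ ^ (p - 2) * δ)
  have hM : 0 ≤ M := by positivity
  refine norm_pLaplacian_sub_le
    (h := fun x => M * ((σ ^ (p - 1))⁻¹ * ‖f x‖ ^ (p - 1) + (σ ^ (p - 1))⁻¹ * ‖g x‖ ^ (p - 1) +
      (δ ^ (p - 1))⁻¹ * ‖k x‖ ^ (p - 1))) (by positivity) ?_ fun v => ?_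
  · have hkfg : k = f - g := by rw [hk, map_sub]
    rw [hkfg]
    filter_upwards [Lp.coeFn_sub f g] with x hx
    rw [hx]
    refine (norm_rpow_smul_sub_le_of_two_le h2 (f x) (g x)).trans ?_
    have := add_rpow_mul_le_scaled h2 (norm_nonneg (f x)) (norm_nonneg (g x))
      (norm_nonneg (f x - g x)) hσ hδ
    have := mul_le_mul_of_nonneg_left this hp0.le
    simp only [M, Pi.sub_apply]
    linarith
  · have hI : ∀ c : ℝ, ∀ k : LebesgueVec Ω p,
        Integrable (fun x => c * (‖k x‖ ^ (p - 1) * ‖v x‖)) Ω.measure := fun c k =>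
      (integrable_norm_rpow_mul_norm k v).const_mul c
    have hle : ∀ (c : ℝ) (k : LebesgueVec Ω p), 0 < c → ‖k‖ ≤ c →
        -- After normalization each of the three terms contributes at most `‖v‖`, whence the factor
        -- `3` in the constant.
        ∫ x in Ω.carrier, (c ^ (p - 1))⁻¹ * (‖k x‖ ^ (p - 1) * ‖v x‖) ≤ ‖v‖ := by
      intro c k hc hkc
      have hc' : 0 < c ^ (p - 1) := by positivity
      rw [integral_const_mul, inv_mul_le_iff₀ hc']
      refine (integral_norm_rpow_mul_norm_le k v).trans ?_
      gcongr
      linarith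
    have heq : ∀ x, M * ((σ ^ (p - 1))⁻¹ * ‖f x‖ ^ (p - 1) + (σ ^ (p - 1))⁻¹ * ‖g x‖ ^ (p - 1) +
        (δ ^ (p - 1))⁻¹ * ‖k x‖ ^ (p - 1)) * ‖v x‖ =
        M * ((σ ^ (p - 1))⁻¹ * (‖f x‖ ^ (p - 1) * ‖v x‖) +
          (σ ^ (p - 1))⁻¹ * (‖g x‖ ^ (p - 1) * ‖v x‖) +
          (δ ^ (p - 1))⁻¹ * (‖k x‖ ^ (p - 1) * ‖v x‖)) := fun x => by ring
    simp only [heq]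
    have hIfg : Integrable (fun x => (σ ^ (p - 1))⁻¹ * (‖f x‖ ^ (p - 1) * ‖v x‖) +
        (σ ^ (p - 1))⁻¹ * (‖g x‖ ^ (p - 1) * ‖v x‖)) Ω.measure := (hI _ f).add (hI _ g)
    refine ⟨(hIfg.add (hI _ k)).const_mul M, ?_⟩
    rw [integral_const_mul, integral_add hIfg (hI _ k),
      integral_add (hI _ f) (hI _ g)]
    have hf := hle σ f hσ (le_add_of_nonneg_right (norm_nonneg w))
    have hg := hle σ g hσ (le_add_of_nonneg_left (norm_nonneg u))
    have hk' := hle δ k hδ le_rfl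
    calc _ ≤ M * (‖v‖ + ‖v‖ + ‖v‖) := by gcongr
      _ = _ := by simp only [M]; ring

theorem isMonotonicityConst_of_two_le (h2 : 2 ≤ p) :
    IsMonotonicityConst Ω p (2 / (p * 2 ^ (p - 1))) := by
  intro u w
  rw [if_pos h2]
  exact isDualityMap_pLaplacian.strongly_monotone hp.out (SobolevZero.clarkson h2) u w

/-- Weighted AM-GM for `x ^ q = (s ^ (q - 2) x ^ 2) ^ (q / 2) (s ^ q) ^ (1 - q / 2)`. For `s = 0`
this factorization is lost, so `x = 0` is required. -/
theorem rpow_le_young {q x s : ℝ} (hq1 : 1 < q) (hq : q < 2) (hx : 0 ≤ x) (hs : 0 ≤ s)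
    (h0 : s = 0 → x = 0) :
    x ^ q ≤ q / 2 * (s ^ (q - 2) * x ^ 2) + (1 - q / 2) * s ^ q := by
  rcases hs.eq_or_lt with h | h
  · rw [h0 h.symm, ← h, Real.zero_rpow (by linarith)]
    simp
  have hG := Real.geom_mean_le_arith_mean2_weighted (w₁ := q / 2) (w₂ := 1 - q / 2)
    (p₁ := s ^ (q - 2) * x ^ 2) (p₂ := s ^ q) (by linarith) (by linarith) (by positivity)
    (by positivity) (by ring)
  refine le_trans (le_of_eq ?_) hG
  rw [Real.mul_rpow (by positivity) (by positivity), ← Real.rpow_mul h.le, ← Real.rpow_mul h.le,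
    ← Real.rpow_natCast, ← Real.rpow_mul hx, mul_right_comm, ← Real.rpow_add h]
  have h1 : (q - 2) * (q / 2) + q * (1 - q / 2) = 0 := by ring
  have h2 : ((2 : ℕ) : ℝ) * (q / 2) = q := by push_cast; ring
  rw [h1, h2, Real.rpow_zero, one_mul]

theorem isMonotonicityConst_of_lt_two (h2 : p < 2) :
    IsMonotonicityConst Ω p ((p - 1) * 2 ^ (p - 2)) := by
  intro u w
  rw [if_neg (not_le.mpr h2)]
  have hp1 : 0 < p - 1 := by linarith [hp.out]
  have hp0 : 0 < p := by linarith
  rcases (norm_nonneg (u - w)).eq_or_lt with h0 | hδ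
  · have : u = w := sub_eq_zero.mp (norm_eq_zero.mp h0.symm)
    simp [this]
  have hσ : 0 < ‖u‖ + ‖w‖ := hδ.trans_le (norm_sub_le u w)
  rw [pLaplacian_sub_apply]
  have hkfg : SobolevZero.grad Ω p (u - w) = SobolevZero.grad Ω p u - SobolevZero.grad Ω p w :=
    map_sub _ _ _
  have hnorm : ∀ v : SobolevZero Ω p, ∫ x in Ω.carrier, ‖SobolevZero.grad Ω p v x‖ ^ p = ‖v‖ ^ p :=
    fun v => (LebesgueVec.norm_rpow _).symm
  have hnf := hnorm u
  have hng := hnorm w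
  have hnk := hnorm (u - w)
  set k := SobolevZero.grad Ω p (u - w)
  set f := SobolevZero.grad Ω p u
  set g := SobolevZero.grad Ω p w
  let I : EuclideanSpace ℝ (Fin d) → ℝ := fun x =>
    ‖f x‖ ^ (p - 2) * inner ℝ (f x) (k x) - ‖g x‖ ^ (p - 2) * inner ℝ (g x) (k x)
  have hI : Integrable I Ω.measure := (integrable_pLaplacian f k).sub (integrable_pLaplacian g k)
  -- Young's inequality will be applied to `‖k‖ / δ` and `(‖f‖ + ‖g‖) / τ`. The first has `p`-th
  -- power integral `1`; the factor `2` in `τ` absorbs the convexity constant `2 ^ (p - 1)`, so the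
  -- second has at most `1`. It is also the origin of `2 ^ (p - 2)` in the result.
  set τ := 2 * (‖u‖ + ‖w‖) with hτdef
  set δ := ‖u - w‖
  have hτ : 0 < τ := by positivity
  let L := (p - 1) * (τ ^ (p - 2) * δ ^ 2)
  have hL : 0 < L := by positivity
  let N := (1 - p / 2) * (2 ^ (p - 1) / τ ^ p)
  have hN : 0 ≤ N := mul_nonneg (by linarith) (by positivity)
  have hpt : ∀ᵐ x ∂Ω.measure, (δ ^ p)⁻¹ * ‖k x‖ ^ p ≤
      p / 2 / L * I x + N * (‖f x‖ ^ p + ‖g x‖ ^ p) := by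
    filter_upwards [Lp.coeFn_sub f g] with x hx
    have hkx : k x = f x - g x := by rw [hkfg, hx, Pi.sub_apply]
    have hk0 : ‖k x‖ ≤ ‖f x‖ + ‖g x‖ := by rw [hkx]; exact norm_sub_le _ _
    have hS : 0 ≤ ‖f x‖ + ‖g x‖ := by positivity
    have hy := rpow_le_young hp.out h2 (div_nonneg (norm_nonneg (k x)) hδ.le)
      (div_nonneg hS hτ.le) (fun h => by
        have h1 : ‖f x‖ + ‖g x‖ = 0 := by simpa [hτ.ne'] using h
        rw [h1] at hk0
        rw [le_antisymm hk0 (norm_nonneg _), zero_div])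
    have hin : (p - 1) * ((‖f x‖ + ‖g x‖) ^ (p - 2) * ‖k x‖ ^ 2) ≤ I x := by
      simp only [I, hkx]
      exact inner_rpow_smul_sub_ge_of_lt_two hp.out h2 (f x) (g x)
    have hconv : (‖f x‖ + ‖g x‖) ^ p ≤ 2 ^ (p - 1) * (‖f x‖ ^ p + ‖g x‖ ^ p) :=
      NNReal.rpow_add_le_mul_rpow_add_rpow ‖f x‖₊ ‖g x‖₊ hp.out.le
    rw [Real.div_rpow (norm_nonneg _) hδ.le, Real.div_rpow hS hτ.le, Real.div_rpow hS hτ.le,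
      div_pow] at hy
    calc (δ ^ p)⁻¹ * ‖k x‖ ^ p = ‖k x‖ ^ p / δ ^ p := by ring
      _ ≤ _ := hy
      _ = p / 2 / L * ((p - 1) * ((‖f x‖ + ‖g x‖) ^ (p - 2) * ‖k x‖ ^ 2)) +
          (1 - p / 2) * ((‖f x‖ + ‖g x‖) ^ p / τ ^ p) := by
        simp only [L]
        field_simp
      _ ≤ p / 2 / L * I x + (1 - p / 2) * (2 ^ (p - 1) * (‖f x‖ ^ p + ‖g x‖ ^ p) / τ ^ p) := by
        have : 0 ≤ 1 - p / 2 := by linarith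
        gcongr
      _ = _ := by simp only [N]; ring
  have hfg : Integrable (fun x => ‖f x‖ ^ p + ‖g x‖ ^ p) Ω.measure :=
    f.integrable_norm_rpow.add g.integrable_norm_rpow
  have hint : ∫ x in Ω.carrier, (δ ^ p)⁻¹ * ‖k x‖ ^ p ≤
      ∫ x in Ω.carrier, (p / 2 / L * I x + N * (‖f x‖ ^ p + ‖g x‖ ^ p)) :=
    integral_mono_ae (k.integrable_norm_rpow.const_mul _)
      ((hI.const_mul (p / 2 / L)).add (hfg.const_mul N)) hpt
  rw [integral_const_mul, integral_add (hI.const_mul _) (hfg.const_mul N), integral_const_mul,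
    integral_const_mul, integral_add f.integrable_norm_rpow g.integrable_norm_rpow, hnf, hng, hnk,
    inv_mul_cancel₀ (by positivity)] at hint
  have hNle : N * (‖u‖ ^ p + ‖w‖ ^ p) ≤ 1 - p / 2 := by
    have h1 : ‖u‖ ^ p + ‖w‖ ^ p ≤ (‖u‖ + ‖w‖) ^ p :=
      Real.add_rpow_le_rpow_add (norm_nonneg _) (norm_nonneg _) hp.out.le
    have h3 : (2 : ℝ) ^ (p - 1) ≤ 2 ^ p :=
      Real.rpow_le_rpow_of_exponent_le one_le_two (by linarith)
    have h4 : 2 ^ (p - 1) / τ ^ p * (‖u‖ ^ p + ‖w‖ ^ p) ≤ 1 := by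
      rw [div_mul_eq_mul_div, div_le_one (by positivity), hτdef,
        Real.mul_rpow (by norm_num) hσ.le]
      gcongr
    calc N * (‖u‖ ^ p + ‖w‖ ^ p) = (1 - p / 2) * (2 ^ (p - 1) / τ ^ p * (‖u‖ ^ p + ‖w‖ ^ p)) := by
          simp only [N]; ring
      _ ≤ (1 - p / 2) * 1 := by
          have : 0 ≤ 1 - p / 2 := by linarith
          gcongr
      _ = 1 - p / 2 := mul_one _
  -- The term `1 - p / 2` cancels on both sides of the integrated Young inequality and leaves `p /
  -- 2` on the left.
  have hfin : L ≤ ∫ x in Ω.carrier, I x := by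
    have h1 : p / 2 ≤ p / 2 / L * ∫ x in Ω.carrier, I x := by linarith
    rw [div_mul_eq_mul_div, le_div_iff₀ hL] at h1
    exact le_of_mul_le_mul_left h1 (by positivity)
  calc _ = L := by
        simp only [L]
        rw [hτdef, Real.mul_rpow (by norm_num) hσ.le]
        ring
    _ ≤ _ := hfin

end Operator

section Estimates

variable {d : ℕ} [NeZero d] {Ω : BoundedOpen d} {p : ℝ} [hp : Fact (1 < p)]

/-! ### The error estimates -/

theorem exists_continuityConst_monotonicityConst (p : ℝ) [hp : Fact (1 < p)] :
    ∃ CL CM : ℝ, 0 < CL ∧ 0 < CM ∧ ∀ (d : ℕ) [NeZero d] (Ω : BoundedOpen d),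
      IsContinuityConst Ω p CL ∧ IsMonotonicityConst Ω p CM := by
  have hp1 : 0 < p - 1 := by linarith [hp.out]
  have hp0 : 0 < p := by linarith
  rcases le_or_gt 2 p with h | h
  · exact ⟨p * 2 ^ (p - 2) * 3, 2 / (p * 2 ^ (p - 1)), by positivity, by positivity,
      fun d _ Ω => ⟨isContinuityConst_of_two_le h, isMonotonicityConst_of_two_le h⟩⟩
  · exact ⟨4, (p - 1) * 2 ^ (p - 2), by positivity, by positivity,
      fun d _ Ω => ⟨isContinuityConst_of_lt_two h, isMonotonicityConst_of_lt_two h⟩⟩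

theorem norm_pLaplacian (u : SobolevZero Ω p) : ‖pLaplacian Ω p u‖ = ‖u‖ ^ (p - 1) :=
  (isDualityMap_pLaplacian u).2

theorem norm_pLaplacian_rpow (u : SobolevZero Ω p) (c : ℝ) :
    ‖pLaplacian Ω p u‖ ^ (c / (p - 1)) = ‖u‖ ^ c := by
  rw [norm_pLaplacian, ← Real.rpow_mul (norm_nonneg _),
    mul_div_cancel₀ _ (by linarith [hp.out])]

variable {CL CM : ℝ} {u uh r : SobolevZero Ω p}

theorem pLaplacian_sub_apply_le (hr : ‖pLaplacian Ω p u - pLaplacian Ω p uh‖ = ‖r‖ ^ (p - 1)) :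
    (pLaplacian Ω p u - pLaplacian Ω p uh) (u - uh) ≤ ‖r‖ ^ (p - 1) * ‖u - uh‖ := by
  rw [← hr]
  exact (le_abs_self _).trans
    ((pLaplacian Ω p u - pLaplacian Ω p uh).le_opNorm (u - uh))

theorem le_norm_sub_of_two_le (h2 : 2 ≤ p) (hCL : 0 < CL) (hL : IsContinuityConst Ω p CL)
    {B : ℝ} (hB : 1 ≤ B)
    (huh : ‖pLaplacian Ω p uh‖ ≤ B * ‖pLaplacian Ω p u‖)
    (hr : ‖pLaplacian Ω p u - pLaplacian Ω p uh‖ = ‖r‖ ^ (p - 1)) :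
    CL⁻¹ * (1 + B) ^ (2 - p) * ‖pLaplacian Ω p u‖ ^ (-((p - 2) / (p - 1))) * ‖r‖ ^ (p - 1) ≤
      ‖u - uh‖ := by
  have hp1 : 0 < p - 1 := by linarith
  have huhB : ‖uh‖ ≤ B * ‖u‖ := by
    rw [norm_pLaplacian, norm_pLaplacian] at huh
    -- The sharper factor `B ^ (1 / (p - 1))` is relaxed to `B`, using `B ≥ 1` and `p - 1 ≥ 1`.
    have hBp : B ≤ B ^ (p - 1) := by
      simpa using Real.rpow_le_rpow_of_exponent_le hB (show 1 ≤ p - 1 by linarith)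
    refine (Real.rpow_le_rpow_iff (norm_nonneg _) (by positivity) hp1).mp (huh.trans ?_)
    rw [Real.mul_rpow (by positivity) (norm_nonneg _)]
    gcongr
  rcases (norm_nonneg u).eq_or_lt with h0 | hu
  · have hu0 : u = 0 := norm_eq_zero.mp h0.symm
    have huh0 : uh = 0 := by
      rw [← h0, mul_zero] at huhB
      exact norm_le_zero_iff.mp huhB
    rw [← hr, hu0, huh0, sub_self, norm_zero, mul_zero]
    exact norm_nonneg _
  have hLu := hL u uh
  rw [if_pos h2, hr] at hLu
  rw [← neg_div, norm_pLaplacian_rpow, show 2 - p = -(p - 2) by ring,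
    Real.rpow_neg (by positivity), Real.rpow_neg hu.le, ← mul_inv, ← mul_inv,
    inv_mul_le_iff₀ (by positivity)]
  refine hLu.trans ?_
  rw [mul_assoc CL (_ ^ _) (_ ^ _), ← Real.mul_rpow (by positivity) hu.le]
  gcongr
  linarith

theorem norm_sub_le_of_two_le (h2 : 2 ≤ p) (hCM : 0 < CM) (hM : IsMonotonicityConst Ω p CM)
    (hr : ‖pLaplacian Ω p u - pLaplacian Ω p uh‖ = ‖r‖ ^ (p - 1)) :
    ‖u - uh‖ ≤ CM ^ (-(1 / (p - 1))) * ‖r‖ := by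
  have hp1 : 0 < p - 1 := by linarith
  rcases (norm_nonneg (u - uh)).eq_or_lt with h0 | hD
  · rw [← h0]
    positivity
  have hMu := (hM u uh).trans (pLaplacian_sub_apply_le hr)
  rw [if_pos h2] at hMu
  have hpow : ‖u - uh‖ ^ p = ‖u - uh‖ ^ (p - 1) * ‖u - uh‖ := by
    rw [← Real.rpow_add_one hD.ne', sub_add_cancel]
  rw [hpow, ← mul_assoc] at hMu
  -- One factor `‖u - uh‖` cancels; the `(p - 1)`-th root of the rest is the claim.
  have h1 := le_of_mul_le_mul_right hMu hD
  refine (Real.rpow_le_rpow_iff hD.le (by positivity) hp1).mp ?_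
  rw [Real.mul_rpow (by positivity) (norm_nonneg _), ← Real.rpow_mul hCM.le, neg_mul,
    one_div_mul_cancel hp1.ne', Real.rpow_neg_one, le_inv_mul_iff₀ hCM]
  exact h1

theorem le_norm_sub_of_lt_two (h2 : p < 2) (hCL : 0 < CL) (hL : IsContinuityConst Ω p CL)
    (hr : ‖pLaplacian Ω p u - pLaplacian Ω p uh‖ = ‖r‖ ^ (p - 1)) :
    CL ^ (-(1 / (p - 1))) * ‖r‖ ≤ ‖u - uh‖ := by
  have hp1 : 0 < p - 1 := by linarith [hp.out]
  have hLu := hL u uh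
  rw [if_neg (not_le.mpr h2), hr] at hLu
  refine (Real.rpow_le_rpow_iff (by positivity) (norm_nonneg _) hp1).mp ?_
  rwa [Real.mul_rpow (by positivity) (norm_nonneg _), ← Real.rpow_mul hCL.le, neg_mul,
    one_div_mul_cancel hp1.ne', Real.rpow_neg_one, inv_mul_le_iff₀ hCL]

theorem norm_sub_le_of_lt_two (h2 : p < 2) (hCM : 0 < CM) (hM : IsMonotonicityConst Ω p CM)
    (huh : ‖pLaplacian Ω p uh‖ ≤ 2 * ‖pLaplacian Ω p u‖)
    (hr : ‖pLaplacian Ω p u - pLaplacian Ω p uh‖ = ‖r‖ ^ (p - 1)) :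
    ‖u - uh‖ ≤ CM⁻¹ * (1 + (2 : ℝ) ^ (1 / (p - 1))) ^ (2 - p) *
      ‖pLaplacian Ω p u‖ ^ ((2 - p) / (p - 1)) * ‖r‖ ^ (p - 1) := by
  have hp1 : 0 < p - 1 := by linarith [hp.out]
  rw [norm_pLaplacian_rpow]
  rcases (norm_nonneg (u - uh)).eq_or_lt with h0 | hD
  · rw [← h0]
    positivity
  have hσ : 0 < ‖u‖ + ‖uh‖ := hD.trans_le (norm_sub_le u uh)
  have huh2 : ‖uh‖ ≤ 2 ^ (1 / (p - 1)) * ‖u‖ := by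
    rw [norm_pLaplacian, norm_pLaplacian] at huh
    refine (Real.rpow_le_rpow_iff (norm_nonneg _) (by positivity) hp1).mp (huh.trans_eq ?_)
    rw [Real.mul_rpow (by positivity) (norm_nonneg _), ← Real.rpow_mul (by norm_num),
      one_div_mul_cancel hp1.ne', Real.rpow_one]
  have hMu := (hM u uh).trans (pLaplacian_sub_apply_le hr)
  rw [if_neg (not_le.mpr h2), sq, ← mul_assoc] at hMu
  have h1 := le_of_mul_le_mul_right hMu hD
  rw [show p - 2 = -(2 - p) by ring, Real.rpow_neg hσ.le, ← div_eq_mul_inv, div_mul_eq_mul_div,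
    div_le_iff₀ (by positivity)] at h1
  have h3 : (‖u‖ + ‖uh‖) ^ (2 - p) ≤ (1 + 2 ^ (1 / (p - 1))) ^ (2 - p) * ‖u‖ ^ (2 - p) := by
    rw [← Real.mul_rpow (by positivity) (norm_nonneg _)]
    gcongr
    linarith
  rw [mul_assoc, mul_assoc, le_inv_mul_iff₀ hCM, ← mul_assoc]
  refine h1.trans ?_
  rw [mul_comm]
  gcongr

end Estimates

end PLaplaceMinRes

open PLaplaceMinRes in
theorem mainTheorem3 (p : ℝ) [Fact (1 < p)] :
    -- the continuity and monotonicity constants exist and depend only on `p`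
    (∃ CL CM : ℝ, 0 < CL ∧ 0 < CM ∧ ∀ (d : ℕ) [NeZero d] (Ω : BoundedOpen d),
      IsContinuityConst Ω p CL ∧ IsMonotonicityConst Ω p CM) ∧
    -- the error estimates, for any such constants
    ∀ (d : ℕ) [NeZero d] (Ω : BoundedOpen d) (CL CM : ℝ), 0 < CL → 0 < CM →
      IsContinuityConst Ω p CL → IsMonotonicityConst Ω p CM →
      ∀ (F : StrongDual ℝ (SobolevZero Ω p)) (u : SobolevZero Ω p), pLaplacian Ω p u = F →
      ∀ (Uh : Submodule ℝ (SobolevZero Ω p)) [FiniteDimensional ℝ Uh] (uh : SobolevZero Ω p),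
        IsMinResSolution p (pLaplacian Ω p) F Uh uh →
      ∀ r : SobolevZero Ω p, dualityMap p (SobolevZero Ω p) r = F - pLaplacian Ω p uh →
        (2 ≤ p →
          CL⁻¹ * (1 + banachMazurConst (SobolevZero Ω p)) ^ (2 - p) *
              ‖F‖ ^ (-((p - 2) / (p - 1))) * ‖r‖ ^ (p - 1) ≤ ‖u - uh‖ ∧
            ‖u - uh‖ ≤ CM ^ (-(1 / (p - 1))) * ‖r‖) ∧
        (p < 2 →
          CL ^ (-(1 / (p - 1))) * ‖r‖ ≤ ‖u - uh‖ ∧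
            ‖u - uh‖ ≤ CM⁻¹ * (1 + (2 : ℝ) ^ (1 / (p - 1))) ^ (2 - p) *
              ‖F‖ ^ ((2 - p) / (p - 1)) * ‖r‖ ^ (p - 1)) := by
  refine ⟨exists_continuityConst_monotonicityConst p, ?_⟩
  intro d _ Ω CL CM hCL hCM hL hM F u hu Uh _ uh huh r hr
  subst hu
  have hp : 1 < p := Fact.out
  have hJ := dualityMap_spec p (SobolevZero Ω p)
  have hrn : ‖pLaplacian Ω p u - pLaplacian Ω p uh‖ = ‖r‖ ^ (p - 1) := by rw [← hr, (hJ r).2]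
  refine ⟨fun h2 => ⟨le_norm_sub_of_two_le h2 hCL hL one_le_banachMazurConst ?_ hrn,
    norm_sub_le_of_two_le h2 hCM hM hrn⟩,
    fun h2 => ⟨le_norm_sub_of_lt_two h2 hCL hL hrn, norm_sub_le_of_lt_two h2 hCM hM ?_ hrn⟩⟩
  · exact huh.norm_apply_le hp (SobolevZero.clarkson h2) isDualityMap_pLaplacian
      (fun t x ht => pLaplacian_smul ht x) hJ hr
  · have h0 : pLaplacian Ω p (0 : SobolevZero Ω p) = 0 := by
      rw [← norm_eq_zero, norm_pLaplacian, norm_zero, Real.zero_rpow (by linarith)]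
    -- The competitor `0` yields the factor `2` by the triangle inequality.
    have h1 := huh.norm_le hp Uh.zero_mem
    rw [h0, sub_zero] at h1
    have h3 := norm_sub_norm_le (pLaplacian Ω p uh) (pLaplacian Ω p u)
    rw [norm_sub_rev] at h3
    linarith
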